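/- For $n\ge 1$ consider strings $\omega=(\omega_1,\dots,\omega_n)\in\{0,1,2\}^n$. Let $Z$ be the evolution step that simultaneously swaps all adjacent increasing pairs $01\to10$, $02\to20$, $12\to21$ of a string, where in a substring $012$ the pair $12$ has priority, so that $012$ becomes $021$. On strings in $\{0,2\}^n$, let $Z^{(2)}$ be the step that replaces every occurrence of $02$ by $20$. Let $\Pi_1:\{0,1,2\}^n\to\{0,2\}^n$ be the map that replaces each letter $1$ by $0$. Define the stabilization times $$T_n(\omega)=\min\{k\ge0: Z^k(\omega)=Z^{k+1}(\omega)\},\qquad T_n^{(2)}(\eta)=\min\{k\ge0:(Z^{(2)})^k(\eta)=(Z^{(2)})^{k+1}(\eta)\}$$ for $\omega\in\{0,1,2\}^n$ and $\eta\in\{0,2\}^n$ (these minima exist), and the excess $E_n(\omega)=T_n(\omega)-T_n^{(2)}(\Pi_1\omega)$. Fix $p\in(0,1)$. Let $\omega\in\{0,1,2\}^n$ be random, constructed as follows. First sample $\omega'\in\{0,2\}^n$ whose letters are independent, equal to $2$ with probability $p$ and to $0$ with probability $1-p$. Given $\omega'$, choose $U$ uniformly among the positions of the $0$s of $\omega'$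 and change the letter at position $U$ into $1$; if $\omega'$ contains no $0$, change the first letter into $1$ instead. The resulting string is $\omega$. **Theorem.** As $n\to\infty$, $E_n(\omega)$ converges in distribution to $1$ if $p>1/2$, to $0$ if $p<1/2$, and, if $p=1/2$, to a random variable $X$ with $\mathbf P(X=0)=\mathbf P(X=1)=1/2$. -/

import Mathlib

open MeasureTheory ProbabilityTheory Filter
open scoped unitInterval

namespace SecondClass

/-- Letters of three types: `0` is a particle, `1` a second class particle, `2` a hole. -/
abbrev Letter : Type := Fin 3

/-- Letters of two types, `{0, 2}`. -/
abbrev BinaryLetter : Type := {a : Letter // a = 0 ∨ a = 2}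

/-- The letter `0` of the two-letter alphabet. -/
def BinaryLetter.zero : BinaryLetter := ⟨0, Or.inl rfl⟩

/-- The letter `2` of the two-letter alphabet. -/
def BinaryLetter.two : BinaryLetter := ⟨2, Or.inr rfl⟩

/-- The string `ω_1 … ω_n` written with positions `1, …, n`, i.e. `pad l r ω k = ω_k` for
`1 ≤ k ≤ n`, and extended by the boundary letters `ω_0 = l` and `ω_k = r` for `k > n`.
(The letter `ω_k` is `ω ⟨k - 1, _⟩` in the indexing by `Fin n`.) -/
def pad {α : Type} (l r : α) {n : ℕ} (ω : Fin n → α) : ℕ → α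
  | 0 => l
  | k + 1 => if h : k < n then ω ⟨k, h⟩ else r

/-! ### Two types -/

/-- The evolution step `Z^{(2)}` for two types: every occurrence of `02` is replaced by `20`.
The boundary letters `2` on the left and `0` on the right never take part in an occurrence
of `02`. -/
def stepTwo {n : ℕ} (ω : Fin n → BinaryLetter) : Fin n → BinaryLetter := fun j =>
  let w := pad BinaryLetter.two BinaryLetter.zero ω
  let i := (j : ℕ) + 1
  if w i = BinaryLetter.zero ∧ w (i + 1) = BinaryLetter.two then BinaryLetter.two
  else if w (i - 1) = BinaryLetter.zero ∧ w i = BinaryLetter.two then BinaryLetter.zero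
  else w i

/-- The stabilization time `T_n^{(2)}(ω) = min {k ≥ 0 : (Z^{(2)})^k ω = (Z^{(2)})^{k+1} ω}`. -/
noncomputable def stabTimeTwo {n : ℕ} (ω : Fin n → BinaryLetter) : ℕ :=
  sInf {k : ℕ | stepTwo^[k] ω = stepTwo^[k + 1] ω}

/-! ### Three types -/

/-- The pair of positions `i, i + 1` of the (extended) string `w` is swapped by the evolution
step: either it is an ascent which does not overlap with another ascent,
`w_{i-1} ≥ w_i < w_{i+1} ≥ w_{i+2}`, or it is the pair `12` in a substring `012`. -/
def Swaps (w : ℕ → Letter) (i : ℕ) : Prop :=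
  (w i ≤ w (i - 1) ∧ w i < w (i + 1) ∧ w (i + 2) ≤ w (i + 1)) ∨
    (w (i - 1) = 0 ∧ w i = 1 ∧ w (i + 1) = 2)

instance (w : ℕ → Letter) (i : ℕ) : Decidable (Swaps w i) := by
  unfold Swaps; infer_instance

/-- The evolution step `Z` for three types: all increasing adjacent pairs `01`, `02`, `12` are
swapped simultaneously, where `12` has priority over `01` in a substring `012`.
The boundary letters `ω_0 = 2` and `ω_{n+1} = 0` make the boundary inequalities
`ω_0 ≥ ω_1` and `ω_n ≥ ω_{n+1}` always satisfied. -/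
def step {n : ℕ} (ω : Fin n → Letter) : Fin n → Letter := fun j =>
  let w := pad 2 0 ω
  let i := (j : ℕ) + 1
  if Swaps w i then w (i + 1)
  else if Swaps w (i - 1) then w (i - 1)
  else w i

/-- The stabilization time `T_n(ω) = min {k ≥ 0 : Z^k ω = Z^{k+1} ω}`. -/
noncomputable def stabTime {n : ℕ} (ω : Fin n → Letter) : ℕ :=
  sInf {k : ℕ | step^[k] ω = step^[k + 1] ω}

/-- The letter projection `π_1`: `π_1(0) = π_1(1) = 0` and `π_1(2) = 2`. -/
def proj (a : Letter) : BinaryLetter :=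
  if a = 2 then BinaryLetter.two else BinaryLetter.zero

/-- The excess `E_n(ω) = T_n(ω) - T_n^{(2)}(Π_1 ω)`. -/
noncomputable def excess {n : ℕ} (ω : Fin n → Letter) : ℤ :=
  (stabTime ω : ℤ) - (stabTimeTwo (fun j => proj (ω j)) : ℤ)

/-! ### Both dynamics stabilize, so that the minima above are over nonempty sets -/

lemma exists_iterate_eq {α : Type} [LinearOrder α] [Finite α] {n : ℕ}
    (f : (Fin n → α) → Fin n → α)
    (hf : ∀ ω j, (∀ k < j, f ω k = ω k) → ω j ≤ f ω j) (ω : Fin n → α) :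
    ∃ k, f^[k] ω = f^[k + 1] ω := by
  have hle : ∀ ω : Fin n → α, toLex ω ≤ toLex (f ω) := by
    intro ω
    by_contra hlt
    rw [not_le] at hlt
    obtain ⟨j, h1, h2⟩ := hlt
    exact absurd (hf ω j fun k hk => h1 k hk) (not_le.mpr h2)
  have hmono : Monotone fun k => toLex (f^[k] ω) := by
    refine monotone_nat_of_le_succ fun k => ?_
    rw [Function.iterate_succ_apply']
    exact hle _
  have : Finite (Lex (Fin n → α)) := inferInstanceAs (Finite (Fin n → α))
  obtain ⟨k, hk⟩ := WellFoundedGT.monotone_chain_condition ⟨_, hmono⟩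
  exact ⟨k, toLex.injective (hk (k + 1) (Nat.le_succ k))⟩

lemma pad_succ {α : Type} (l r : α) {n : ℕ} (ω : Fin n → α) (j : Fin n) :
    pad l r ω ((j : ℕ) + 1) = ω j := by
  simp [pad]

lemma exists_step_iterate_eq {n : ℕ} (ω : Fin n → Letter) :
    ∃ k, step^[k] ω = step^[k + 1] ω := by
  refine exists_iterate_eq step (fun ω j hj => ?_) ω
  have hlt : ∀ i, Swaps (pad 2 0 ω) i → pad 2 0 ω i < pad 2 0 ω (i + 1) := by
    rintro i (h | ⟨-, h1, h2⟩)
    · exact h.2.1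
    · rw [h1, h2]; decide
  simp only [step]
  split_ifs with h1 h2
  · exact (pad_succ 2 0 ω j ▸ hlt _ h1).le
  · exfalso
    obtain ⟨j, hjn⟩ := j
    cases j with
    | zero => exact absurd (hlt _ h2) (not_lt.mpr (Fin.le_last _))
    | succ k =>
      have h3 := hj ⟨k, by omega⟩ (by simp)
      have h4 := hlt _ h2
      simp only [Nat.add_sub_cancel] at h2 h4
      simp only [step, h2, if_true] at h3
      rw [h3, ← pad_succ 2 0 ω ⟨k, by omega⟩] at h4
      exact lt_irrefl _ h4
  · exact (pad_succ 2 0 ω j).ge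

lemma exists_stepTwo_iterate_eq {n : ℕ} (ω : Fin n → BinaryLetter) :
    ∃ k, stepTwo^[k] ω = stepTwo^[k + 1] ω := by
  refine exists_iterate_eq stepTwo (fun ω j hj => ?_) ω
  simp only [stepTwo]
  split_ifs with h1 h2
  · rw [pad_succ] at h1
    rw [h1.1]; decide
  · exfalso
    obtain ⟨j, hjn⟩ := j
    cases j with
    | zero => exact absurd (show BinaryLetter.two = BinaryLetter.zero from h2.1) (by decide)
    | succ k =>
      have h3 := hj ⟨k, by omega⟩ (by simp)
      simp only [Nat.add_sub_cancel] at h2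
      simp only [stepTwo, h2, and_self, if_true] at h3
      rw [← pad_succ BinaryLetter.two BinaryLetter.zero ω ⟨k, by omega⟩, h2.1] at h3
      exact absurd h3 (by decide)
  · exact (pad_succ _ _ ω j).ge

/-! ### The random initial string -/

/-- Given `ω'`, a uniformly chosen `0` of `ω'` is changed into `1`; if `ω'` has no `0`, then
the first letter of `ω'` is changed into `1`. -/
noncomputable def placeSecondClass {n : ℕ} (ω' : Fin n → Letter) : PMF (Fin n → Letter) :=
  if h : (Finset.univ.filter fun i => ω' i = 0).Nonempty then
    (PMF.uniformOfFinset _ h).map fun u => Function.update ω' u 1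
  else PMF.pure fun i => if (i : ℕ) = 0 then 1 else ω' i

/-- The Bernoulli initial condition of parameter `p` with a second class particle in uniform
position: sample `ω'` with independent letters, equal to `2` with probability `p` and to `0`
with probability `1 - p`, and then place the `1` as in `placeSecondClass`. -/
noncomputable def initialLaw (p : I) (n : ℕ) : Measure (Fin n → Letter) :=
  (Measure.pi fun _ : Fin n => bernoulliMeasure (2 : Letter) 0 p).bind
    fun ω' => (placeSecondClass ω').toMeasure

instance (p : I) (n : ℕ) : IsProbabilityMeasure (initialLaw p n) := by
  unfold initialLaw
  refine isProbabilityMeasure_bind (Measurable.of_discrete).aemeasurable ?_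
  exact Eventually.of_forall fun ω' => inferInstance

end SecondClass

/-! Read the letters 0 and 1 as particles and 2 as holes, and continue the string by particles to
the right of `n`. If 0 and 1 are not distinguished, every particle jumps right when the next site is
free. The letter 1 is a mark carried by one of the particles; it can only be handed to the particle
behind. Let `T` be the time at which all particles are jammed, that is, the two-letter stabilization
time. From then on the mark goes down one label per step until it rests at label 0, so the excess is
the label of the mark at time `T` (`excess_eq_markAt`).

Blocking propagates: if particle `k` is blocked after a step, then particle `k + 1` was blocked
before it. If particle 0 is blocked at two consecutive times, the two diagonals traced back in this
way carry the mark down to label 0 (`markAt_eq_zero`). At the times `T` and `T + 1` this shows that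
the label at time `T` is at most one.

Consider the walk that steps up at a particle and down at a hole. If the particle with label `r + 1`
sits at a strict record height, then particle 0 is blocked at time `r`. Hence two adjacent particles
at record heights to the right of the mark bring it to label 0 before `T`, and the excess is 0
(`excess_eq_zero`). If instead a particle to the left of the mark sits at a height that is not
exceeded later, it is blocked only in its final position, so the mark reaches each particle behind
only after that particle has stopped. Label 0 is then impossible at time `T`, and the excess is 1
(`excess_eq_one`).

It remains to locate the maximum of a random walk with up-probability `q = 1 - p`. With downward
drift it lies near the start, to the left of a typical zero; with upward drift records, and among
them double records, occur to the right. For `q = 1/2`, reading the path backwards exchanges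
"maximum before `i`" and "maximum after `i`", so each has averaged probability close to 1/2. Ties
are negligible, because once the old maximum is reached a double record soon follows
(`bernProb_reachNoDouble_le`). Passing from a uniform index to a uniform zero uses that the indices
in question form a segment and that the path is flat on the scale `n`
(`avgProb_le_bernExp_goodFrac`). Lower bounds for both values of the excess suffice, as their limits
add up to one. -/

namespace SecondClass

/-! ### A particle system on `ℕ` with a marked particle -/

/-- One parallel step: each particle moves to the right unless the next site is occupied. -/
def advance (x : ℕ → ℕ) : ℕ → ℕ := fun k => if x (k + 1) = x k + 1 then x k else x k + 1

/-- The label of the marked particle after one step from `x`: the mark is handed to the preceding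
particle if the marked particle has both neighbouring sites occupied. -/
def passMark (x : ℕ → ℕ) (k : ℕ) : ℕ :=
  if 0 < k ∧ x (k + 1) = x k + 1 ∧ x (k - 1) + 1 = x k then k - 1 else k

/-- The label of the marked particle at time `t`. -/
def markAt (x : ℕ → ℕ) (k : ℕ) : ℕ → ℕ
  | 0 => k
  | t + 1 => passMark (advance^[t] x) (markAt x k t)

/-- All particles from label `k` on are blocked. -/
def Jammed (x : ℕ → ℕ) (k : ℕ) : Prop := ∀ i, k ≤ i → x (i + 1) = x i + 1

lemma strictMono_advance {x : ℕ → ℕ} (hx : StrictMono x) : StrictMono (advance x) := by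
  refine strictMono_nat_of_lt_succ fun k => ?_
  have h1 := hx (Nat.lt_succ_self k)
  have h2 := hx (Nat.lt_succ_self (k + 1))
  simp only [advance, Nat.succ_eq_add_one] at *
  split_ifs <;> omega

lemma strictMono_advance_iterate {x : ℕ → ℕ} (hx : StrictMono x) (t : ℕ) :
    StrictMono (advance^[t] x) := by
  induction t with
  | zero => exact hx
  | succ t ih => rw [Function.iterate_succ_apply']; exact strictMono_advance ih

/-- The particle ahead must have stood still: had it moved, there would be a gap after the step,
whether or not particle `k` moved too. -/
lemma blocked_succ_of_blocked_advance {x : ℕ → ℕ} (hx : StrictMono x) {k : ℕ}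
    (h : advance x (k + 1) = advance x k + 1) : x (k + 2) = x (k + 1) + 1 := by
  have h1 := hx (Nat.lt_succ_self k)
  simp only [advance, Nat.succ_eq_add_one] at *
  split_ifs at h <;> first | assumption | omega

/-- Tracing a blocked particle back in time shifts the label by one to the right per step. All later
arguments on the particle dynamics run along these diagonals. -/
lemma blocked_add_of_blocked {x : ℕ → ℕ} (hx : StrictMono x) {s : ℕ} {k : ℕ} :
    ∀ {t : ℕ}, (advance^[t + s] x) (k + 1) = (advance^[t + s] x) k + 1 →
      (advance^[t] x) (k + s + 1) = (advance^[t] x) (k + s) + 1 := by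
  induction s generalizing k with
  | zero => intro t h; exact h
  | succ s ih =>
    intro t h
    rw [← add_assoc, Function.iterate_succ_apply'] at h
    have := ih (blocked_succ_of_blocked_advance (strictMono_advance_iterate hx _) h)
    rwa [show k + 1 + s = k + (s + 1) by ring] at this

lemma Jammed.after_advance {x : ℕ → ℕ} {k : ℕ} (h : Jammed x k) : Jammed (advance x) k := by
  intro i hi
  simp only [advance, h i hi, h (i + 1) (by omega), if_true]

lemma Jammed.iterate {x : ℕ → ℕ} {k s : ℕ} (t : ℕ) (h : Jammed (advance^[s] x) k) :
    Jammed (advance^[s + t] x) k := by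
  induction t with
  | zero => exact h
  | succ t ih => rw [← add_assoc, Function.iterate_succ_apply']; exact ih.after_advance

lemma Jammed.iterate_le {x : ℕ → ℕ} {k s t : ℕ} (h : Jammed (advance^[s] x) k) (hst : s ≤ t) :
    Jammed (advance^[t] x) k := by
  obtain ⟨r, rfl⟩ := Nat.exists_eq_add_of_le hst
  exact h.iterate r

lemma Jammed.of_iterate {x : ℕ → ℕ} (hx : StrictMono x) {k : ℕ}
    (h : Jammed (advance^[k] x) 0) : Jammed x k := by
  intro i hi
  obtain ⟨j, rfl⟩ := Nat.exists_eq_add_of_le' hi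
  have := h j (Nat.zero_le _)
  rw [show k = 0 + k by simp] at this
  exact blocked_add_of_blocked hx this

lemma passMark_le (x : ℕ → ℕ) (k : ℕ) : passMark x k ≤ k := by
  unfold passMark; split_ifs <;> omega

lemma le_passMark_add_one (x : ℕ → ℕ) (k : ℕ) : k ≤ passMark x k + 1 := by
  unfold passMark; split_ifs <;> omega

lemma markAt_anti (x : ℕ → ℕ) (k : ℕ) : Antitone (markAt x k) :=
  antitone_nat_of_succ_le fun _ => passMark_le _ _

/-- If the first particle is blocked at the times `s` and `s + 1`, then it carries the mark at
time `s + 1`, unless the label of the mark was too large initially. -/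
lemma markAt_eq_zero {x : ℕ → ℕ} (hx : StrictMono x) {k s : ℕ} (hk : k ≤ s + 1)
    (h0 : (advance^[s] x) 1 = (advance^[s] x) 0 + 1)
    (h1 : (advance^[s + 1] x) 1 = (advance^[s + 1] x) 0 + 1) : markAt x k (s + 1) = 0 := by
  -- The diagonal `label = s + 1 - t` is a barrier. A mark strictly below it cannot cross it. On it,
  -- tracing back `h1` and `h0` shows that the marked particle and the one behind it are both
  -- blocked, so the mark is handed on.
  have key : ∀ t, t ≤ s + 1 → markAt x k t ≤ s + 1 - t := by
    intro t
    induction t with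
    | zero => intro _; exact hk
    | succ t ih =>
      intro ht
      have h := ih (by omega)
      have hle : markAt x k (t + 1) ≤ markAt x k t := passMark_le _ _
      rcases Nat.lt_or_ge (markAt x k t) (s + 1 - t) with hlt | hge
      · omega
      · have heq : markAt x k t = s - t + 1 := by omega
        have e1 : (advance^[t] x) (s - t + 1 + 1) = (advance^[t] x) (s - t + 1) + 1 := by
          have := blocked_add_of_blocked hx (k := 0) (t := t) (s := s - t + 1)
            (by rw [show t + (s - t + 1) = s + 1 by omega]; exact h1)
          simpa using this
        have e2 : (advance^[t] x) (s - t + 1) = (advance^[t] x) (s - t) + 1 := by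
          have := blocked_add_of_blocked hx (k := 0) (t := t) (s := s - t)
            (by rw [show t + (s - t) = s by omega]; exact h0)
          simpa using this
        have : markAt x k (t + 1) = s - t := by
          change passMark _ _ = _
          rw [heq, passMark, if_pos ⟨by omega, e1, by simpa using e2.symm⟩]
          simp
        omega
  simpa using key (s + 1) le_rfl

/-- The first particle is blocked at time `r` if its label `r + 1` is a strict record minimum of
`k ↦ x k - 2 k`. -/
lemma blocked_zero_of_record {x : ℕ → ℕ} (hx : StrictMono x) {r : ℕ}
    (h : ∀ i < r + 1, x (r + 1) + 2 * i < x i + 2 * (r + 1)) :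
    (advance^[r] x) 1 = (advance^[r] x) 0 + 1 := by
  induction r generalizing x with
  | zero =>
    have h0 := h 0 (by omega)
    have h1 := hx (Nat.lt_succ_self 0)
    simp only [Nat.succ_eq_add_one, zero_add, Function.iterate_zero, id] at *
    omega
  | succ r ih =>
    rw [Function.iterate_succ_apply]
    apply ih (strictMono_advance hx)
    intro i hi
    -- Comparison with the preceding label leaves no gap, so particle `r + 1` stands still and
    -- inherits the record property after the step. Against a label `i` that moves this follows from
    -- `h i`, against a blocked one from `h (i + 1)`.
    have b : x (r + 1 + 1) = x (r + 1) + 1 := by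
      have h0 := h (r + 1) (by omega)
      have h1 := hx (Nat.lt_succ_self (r + 1))
      simp only [Nat.succ_eq_add_one] at *
      omega
    have h1 := h i (by omega)
    have h2 := h (i + 1) (by omega)
    simp only [advance, b, if_true]
    split_ifs with hb <;> omega

/-- A particle which no particle ahead ever catches is blocked only in its final position. -/
lemma Jammed.of_blocked_of_free {x : ℕ → ℕ} (hx : StrictMono x) {j : ℕ}
    (hfree : ∀ i, j ≤ i → x j + 2 * i ≤ x i + 2 * j ∨ Jammed x i) {t : ℕ}
    (ht : (advance^[t] x) (j + 1) = (advance^[t] x) j + 1) : Jammed (advance^[t] x) j := by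
  induction t using Nat.strong_induction_on with
  | _ t ih =>
  -- Jamming persists, so only the first blocking time has to be treated; until then particle `j`
  -- moves at every step.
  by_cases hb : ∃ s < t, (advance^[s] x) (j + 1) = (advance^[s] x) j + 1
  · obtain ⟨s, hst, hs⟩ := hb
    exact (ih s hst hs).iterate_le hst.le
  push Not at hb
  have hmove : ∀ s ≤ t, (advance^[s] x) j = x j + s := by
    intro s
    induction s with
    | zero => intro _; rfl
    | succ s ihs =>
      intro hs
      rw [Function.iterate_succ_apply', advance, if_neg (hb s (by omega)), ihs (by omega)]
      omega
  have hblk : ∀ i ≤ t, (advance^[t - i] x) (j + i + 1) = (advance^[t - i] x) (j + i) + 1 := by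
    intro i hi
    apply blocked_add_of_blocked hx
    rwa [Nat.sub_add_cancel hi]
  -- Particle `j + i + 1` touches particle `j + i` at time `t - i` and, being blocked one step
  -- earlier, was at the same site then. This fixes all positions along the diagonal.
  have hpos : ∀ i ≤ t, (advance^[t - i] x) (j + i) = x j + t + i := by
    intro i
    induction i with
    | zero => intro _; simpa using hmove t le_rfl
    | succ i ihi =>
      intro hi
      have h1 := hblk i (by omega)
      have h2 := ihi (by omega)
      have h3 := hblk (i + 1) hi
      rw [show t - i = t - (i + 1) + 1 by omega, Function.iterate_succ_apply'] at h1 h2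
      have h4 : advance (advance^[t - (i + 1)] x) (j + i + 1) = (advance^[t - (i + 1)] x) (j + i + 1) := by
        exact if_pos h3
      rw [h4] at h1
      rw [← add_assoc, h1, h2]; ring
  -- This is one site too far left for the first alternative of `hfree`, so the diagonal must have
  -- started in the jammed tail.
  have h0 : x (j + t + 1) = x j + 2 * t + 1 := by
    have h1 := hblk t le_rfl
    have h2 := hpos t le_rfl
    simp only [Nat.sub_self, Function.iterate_zero, id] at h1 h2
    omega
  have hj : Jammed x (j + t) := by
    rcases hfree (j + t + 1) (by omega) with h | h
    · omega
    · intro m hm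
      rcases hm.lt_or_eq with hm | rfl
      · exact h m hm
      · simpa using hblk t le_rfl
  -- The jam gains one label per step, and the diagonal supplies the new blocked particle.
  have hall : ∀ i ≤ t, Jammed (advance^[i] x) (j + t - i) := by
    intro i
    induction i with
    | zero => intro _; simpa using hj
    | succ i ihi =>
      intro hi m hm
      rcases Nat.lt_or_ge m (j + t - i) with hlt | hge
      · have := hblk (t - (i + 1)) (by omega)
        rw [show t - (t - (i + 1)) = i + 1 by omega, show j + (t - (i + 1)) = m by omega] at this
        exact this
      · rw [Function.iterate_succ_apply']
        exact (ihi (by omega)).after_advance m hge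
  simpa using hall t le_rfl

/-- If a particle behind the marked one is never blocked before reaching its final position, then
the mark arrives at a given particle only after that particle has stopped. -/
lemma jammed_of_markAt_le {x : ℕ → ℕ} {j k : ℕ} (hjk : j < k)
    (hfree : ∀ t, (advance^[t] x) (j + 1) = (advance^[t] x) j + 1 → Jammed (advance^[t] x) j)
    (t : ℕ) : ∀ i ≤ j, markAt x k t ≤ i → ∃ s < t, Jammed (advance^[s] x) i := by
  induction t with
  | zero => intro i hi h; simp only [markAt] at h; omega
  | succ t ih =>
    intro i hi h
    by_cases hle : markAt x k t ≤ i
    · obtain ⟨s, hs, h⟩ := ih i hi hle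
      exact ⟨s, by omega, h⟩
    · refine ⟨t, by omega, ?_⟩
      change passMark _ _ ≤ i at h
      have hm := le_passMark_add_one (advance^[t] x) (markAt x k t)
      have he : markAt x k t = i + 1 := by omega
      rw [he] at h
      have hp : (advance^[t] x) (i + 1) = (advance^[t] x) i + 1 := by
        unfold passMark at h
        split_ifs at h with hc
        · simpa using hc.2.2.symm
        · omega
      -- The handover shows that particle `i` is blocked at time `t`. For `i < j` the mark was at `i
      -- + 1`, so everything from there on is jammed already and `i` joins the jam; for `i = j` the
      -- hypothesis `hfree` applies.
      rcases hi.lt_or_eq with hlt | rfl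
      · obtain ⟨s, hs, hj⟩ := ih (i + 1) hlt he.le
        intro m hm
        rcases hm.lt_or_eq with hm | rfl
        · exact Jammed.iterate_le hj hs.le m hm
        · exact hp
      · exact hfree t hp

/-! ### The evolution steps as particle systems -/

open Classical in
/-- The word with letter `1` at the particle with label `κ`, `0` at the other particles, and `2`
elsewhere. -/
noncomputable def particleWord (x : ℕ → ℕ) (κ : ℕ) : ℕ → Letter := fun i =>
  if i = x κ then 1 else if i ∈ Set.range x then 0 else 2

open Classical in
/-- The two-letter word with letter `0` at the particles. -/
noncomputable def particleWordTwo (x : ℕ → ℕ) : ℕ → BinaryLetter := fun i =>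
  if i ∈ Set.range x then BinaryLetter.zero else BinaryLetter.two

lemma particleWord_apply {x : ℕ → ℕ} (hx : StrictMono x) (κ k : ℕ) :
    particleWord x κ (x k) = if k = κ then 1 else 0 := by
  simp [particleWord, hx.injective.eq_iff]

lemma particleWord_of_notMem {x : ℕ → ℕ} {κ i : ℕ} (hi : i ∉ Set.range x) :
    particleWord x κ i = 2 := by
  have : i ≠ x κ := fun h => hi ⟨κ, h.symm⟩
  simp [particleWord, this] at hi ⊢
  simpa using hi

lemma particleWord_eq_two_iff {x : ℕ → ℕ} (hx : StrictMono x) {κ i : ℕ} :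
    particleWord x κ i = 2 ↔ i ∉ Set.range x := by
  refine ⟨?_, particleWord_of_notMem⟩
  rintro h ⟨k, rfl⟩
  rw [particleWord_apply hx] at h
  split_ifs at h <;> simp at h

lemma particleWordTwo_eq_two_iff {x : ℕ → ℕ} {i : ℕ} :
    particleWordTwo x i = BinaryLetter.two ↔ i ∉ Set.range x := by
  unfold particleWordTwo
  split_ifs with h
  · simp only [h, not_true, iff_false]; decide
  · simp only [h, not_false_iff]

lemma particleWord_injective {x y : ℕ → ℕ} (hx : StrictMono x) (hy : StrictMono y) {κ μ : ℕ} :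
    particleWord x κ = particleWord y μ ↔ x = y ∧ κ = μ := by
  refine ⟨fun h => ?_, by rintro ⟨rfl, rfl⟩; rfl⟩
  have hr : Set.range x = Set.range y := by
    ext i
    rw [← not_iff_not, ← particleWord_eq_two_iff hx (κ := κ), h, particleWord_eq_two_iff hy]
  obtain rfl := (StrictMono.range_inj hx hy).1 hr
  refine ⟨rfl, ?_⟩
  have := congrFun h (x κ)
  rw [particleWord_apply hx, particleWord_apply hx] at this
  by_contra hne
  simp [hne] at this

lemma particleWordTwo_injective {x y : ℕ → ℕ} (hx : StrictMono x) (hy : StrictMono y) :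
    particleWordTwo x = particleWordTwo y ↔ x = y := by
  refine ⟨fun h => (StrictMono.range_inj hx hy).1 ?_, by rintro rfl; rfl⟩
  ext i
  rw [← not_iff_not, ← particleWordTwo_eq_two_iff, h, particleWordTwo_eq_two_iff]

/-- With three letters two adjacent ascents can only form 012. Hence an ascent is held back only
when it is the 01 of such a triple, and the letter before it is irrelevant. -/
lemma swaps_iff (w : ℕ → Letter) (i : ℕ) :
    Swaps w i ↔ w i < w (i + 1) ∧ ¬ (w i = 0 ∧ w (i + 1) = 1 ∧ w (i + 2) = 2) := by
  unfold Swaps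
  generalize w (i - 1) = a
  generalize w i = b
  generalize w (i + 1) = c
  generalize w (i + 2) = d
  revert a b c d
  decide

/-- The evolution step on infinite words. -/
def stepWord (w : ℕ → Letter) : ℕ → Letter := fun i =>
  if Swaps w i then w (i + 1) else if Swaps w (i - 1) then w (i - 1) else w i

/-- The two-letter evolution step on infinite words. -/
def stepWordTwo (w : ℕ → BinaryLetter) : ℕ → BinaryLetter := fun i =>
  if w i = BinaryLetter.zero ∧ w (i + 1) = BinaryLetter.two then BinaryLetter.two
  else if w (i - 1) = BinaryLetter.zero ∧ w i = BinaryLetter.two then BinaryLetter.zero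
  else w i

lemma pad_of_lt {α : Type} (l r : α) {n : ℕ} (ω : Fin n → α) {i : ℕ} (hi : n < i) :
    pad l r ω i = r := by
  cases i with
  | zero => omega
  | succ i => simp [pad, show ¬ i < n by omega]

lemma pad_injective {α : Type} (l r : α) {n : ℕ} : Function.Injective (pad l r (n := n)) := by
  intro ω ω' h
  funext j
  rw [← pad_succ l r ω j, h, pad_succ]

/-- No ascent can begin at the boundary letter 2 or end at a boundary letter 0, so the padding is
preserved. -/
lemma pad_step {n : ℕ} (ω : Fin n → Letter) : pad 2 0 (step ω) = stepWord (pad 2 0 ω) := by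
  funext i
  rcases Nat.eq_zero_or_pos i with rfl | hi
  · have h : ¬ Swaps (pad 2 0 ω) 0 := by
      rw [swaps_iff]; exact fun h => absurd h.1 (not_lt.2 (Fin.le_last _))
    simp [stepWord, h, pad]
  rcases Nat.lt_or_ge n i with hn | hn
  · have h1 : ¬ Swaps (pad 2 0 ω) i := by
      rw [swaps_iff, pad_of_lt _ _ _ hn, pad_of_lt _ _ _ (by omega)]; simp
    have h2 : ¬ Swaps (pad 2 0 ω) (i - 1) := by
      rw [swaps_iff, show i - 1 + 1 = i by omega, pad_of_lt _ _ _ hn]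
      exact fun h => absurd h.1 (not_lt.2 (Fin.zero_le _))
    simp only [stepWord, h1, h2, if_false]
    rw [pad_of_lt _ _ _ hn, pad_of_lt _ _ _ hn]
  · obtain ⟨j, rfl⟩ : ∃ j, i = j + 1 := ⟨i - 1, by omega⟩
    exact pad_succ 2 0 (step ω) ⟨j, hn⟩

lemma pad_stepTwo {n : ℕ} (ω : Fin n → BinaryLetter) :
    pad BinaryLetter.two BinaryLetter.zero (stepTwo ω)
      = stepWordTwo (pad BinaryLetter.two BinaryLetter.zero ω) := by
  have h20 : BinaryLetter.two ≠ BinaryLetter.zero := by decide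
  funext i
  rcases Nat.eq_zero_or_pos i with rfl | hi
  · simp [stepWordTwo, pad, h20]
  rcases Nat.lt_or_ge n i with hn | hn
  · simp only [stepWordTwo, pad_of_lt _ _ _ hn,
      pad_of_lt BinaryLetter.two BinaryLetter.zero ω (show n < i + 1 by omega), h20.symm, and_false, if_false]
  · obtain ⟨j, rfl⟩ : ∃ j, i = j + 1 := ⟨i - 1, by omega⟩
    exact pad_succ _ _ (stepTwo ω) ⟨j, hn⟩

lemma notMem_range_of_lt_of_lt {x : ℕ → ℕ} (hx : StrictMono x) {k i : ℕ} (h1 : x k < i)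
    (h2 : i < x (k + 1)) : i ∉ Set.range x := by
  rintro ⟨m, rfl⟩
  have h3 := hx.lt_iff_lt.1 h1
  have h4 := hx.lt_iff_lt.1 h2
  omega

lemma succ_mem_range_iff {x : ℕ → ℕ} (hx : StrictMono x) (k : ℕ) :
    x k + 1 ∈ Set.range x ↔ x (k + 1) = x k + 1 := by
  refine ⟨fun h => ?_, fun h => ⟨k + 1, h⟩⟩
  by_contra hne
  have := hx (Nat.lt_succ_self k)
  exact notMem_range_of_lt_of_lt hx (Nat.lt_succ_self _)
    (lt_of_le_of_ne (Nat.succ_le_of_lt this) (Ne.symm hne)) h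

/-- A site is occupied after a step iff it holds a blocked particle, or an unblocked particle was
just before it. -/
lemma mem_range_advance {x : ℕ → ℕ} (i : ℕ) :
    i ∈ Set.range (advance x) ↔ (∃ k, x k = i ∧ x (k + 1) = x k + 1) ∨
      ∃ k, x k + 1 = i ∧ x (k + 1) ≠ x k + 1 := by
  constructor
  · rintro ⟨k, hk⟩
    unfold advance at hk
    split_ifs at hk with h
    · exact Or.inl ⟨k, hk, h⟩
    · exact Or.inr ⟨k, hk, h⟩
  · rintro (⟨k, hk, h⟩ | ⟨k, hk, h⟩)
    · exact ⟨k, by rw [advance, if_pos h, hk]⟩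
    · exact ⟨k, by rw [advance, if_neg h, hk]⟩

lemma passMark_eq_self_iff {x : ℕ → ℕ} {κ : ℕ} :
    passMark x κ = κ ↔ ¬ (0 < κ ∧ x (κ + 1) = x κ + 1 ∧ x (κ - 1) + 1 = x κ) := by
  unfold passMark
  split_ifs with h
  · simp only [h, true_and, not_true, iff_false]; omega
  · simp [h]

lemma pred_mem_range_iff {x : ℕ → ℕ} (hx : StrictMono x) {k : ℕ} (hk : 0 < x k) :
    x k - 1 ∈ Set.range x ↔ 0 < k ∧ x (k - 1) + 1 = x k := by
  refine ⟨?_, fun h => ⟨k - 1, by omega⟩⟩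
  rintro ⟨m, hm⟩
  have h1 : m < k := hx.lt_iff_lt.1 (by omega)
  have h2 : x m ≤ x (k - 1) := hx.monotone (by omega)
  have h3 : x (k - 1) < x k := hx (by omega)
  exact ⟨by omega, by omega⟩

/-- The hypothesis rules out that label `k` receives the mark from `k + 1`, since a handover needs
these two particles to be adjacent. -/
lemma passMark_eq_iff {x : ℕ → ℕ} {κ k : ℕ} (h : κ = k + 1 → x (k + 1) ≠ x k + 1) :
    passMark x κ = k ↔ κ = k ∧ ¬ (0 < k ∧ x (k + 1) = x k + 1 ∧ x (k - 1) + 1 = x k) := by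
  unfold passMark
  split_ifs with hc
  · constructor
    · intro hk
      have : κ = k + 1 := by omega
      subst this
      exact absurd (by simpa using hc.2.2.symm) (h rfl)
    · rintro ⟨rfl, hn⟩; exact absurd hc hn
  · constructor
    · rintro rfl; exact ⟨rfl, hc⟩
    · exact fun hk => hk.1

/-- A free particle changes places with the hole in front and keeps its letter; for the marked one
this is the priority of 12 in 012. A blocked particle keeps its site, and its letter changes only by
a handover: it turns into 1 when the 1 ahead is itself blocked, and into 0 when it is the 1 and has
a particle directly behind. -/
lemma stepWord_particleWord {x : ℕ → ℕ} (hx : StrictMono x) (h0 : 0 < x 0) (κ : ℕ) :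
    stepWord (particleWord x κ) = particleWord (advance x) (passMark x κ) := by
  have hy := strictMono_advance hx
  have hpos : ∀ k, 0 < x k := fun k => h0.trans_le (hx.monotone (Nat.zero_le k))
  set w := particleWord x κ with hw
  have hwx : ∀ k, w (x k) = if k = κ then 1 else 0 := particleWord_apply hx κ
  have hw2 : ∀ i, i ∉ Set.range x → w i = 2 := fun i hi => particleWord_of_notMem hi
  have hpred : ∀ i, 0 < i → (Swaps w (i - 1) ↔
      w (i - 1) < w i ∧ ¬ (w (i - 1) = 0 ∧ w i = 1 ∧ w (i + 1) = 2)) := by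
    intro i hi
    rw [swaps_iff, show i - 1 + 1 = i by omega, show i - 1 + 2 = i + 1 by omega]
  funext i
  unfold stepWord
  by_cases hi : i ∈ Set.range x
  · obtain ⟨k, rfl⟩ := hi
    simp only [hpred _ (hpos k)]
    simp only [swaps_iff]
    by_cases hb : x (k + 1) = x k + 1
    · have hadv : advance x k = x k := if_pos hb
      conv_rhs => rw [← hadv]
      rw [particleWord_apply hy]
      have hw1 : w (x k + 1) = if k + 1 = κ then 1 else 0 := by rw [← hb, hwx]
      rw [hw1, hwx]
      by_cases hκ : κ = k + 1
      · subst hκ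
        by_cases hb2 : x (k + 1 + 1) = x (k + 1) + 1
        · have hp : passMark x (k + 1) = k := by
            rw [passMark, if_pos ⟨by omega, hb2, by simp [hb]⟩]; simp
          have h2 : w (x k + 2) = 0 := by
            rw [show x k + 2 = x (k + 1 + 1) by omega, hwx]; simp
          simp [hp, h2]
        · have hp : passMark x (k + 1) = k + 1 := by
            rw [passMark_eq_self_iff]; tauto
          have h2 : w (x k + 2) = 2 := by
            apply hw2
            rw [← succ_mem_range_iff hx, hb] at hb2; exact hb2
          simp [hp, h2]
      · have hp := passMark_eq_iff (x := x) (κ := κ) (k := k) (fun h => absurd h hκ)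
        simp only [Ne.symm hκ, if_false, not_lt.2 (Fin.zero_le _), false_and]
        by_cases hk : k = κ
        · subst hk
          have hm := pred_mem_range_iff hx (hpos k)
          by_cases hc : 0 < k ∧ x (k - 1) + 1 = x k
          · have ha : w (x k - 1) = 0 := by
              rw [show x k - 1 = x (k - 1) by omega, hwx, if_neg (by omega)]
            have : passMark x k ≠ k := by rw [Ne, hp]; tauto
            simp [ha, this.symm]
          · have ha : w (x k - 1) = 2 := hw2 _ (by rwa [hm])
            have : passMark x k = k := by rw [hp]; tauto
            simp [ha, this]
        · have : passMark x κ ≠ k := by rw [Ne, hp]; tauto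
          simp [hk, this.symm]
    · have h1 : w (x k + 1) = 2 := hw2 _ (by rwa [succ_mem_range_iff hx])
      have h2 : x k ∉ Set.range (advance x) := by
        rw [mem_range_advance]
        rintro (⟨m, hm, hm'⟩ | ⟨m, hm, hm'⟩)
        · obtain rfl := hx.injective hm; exact hb hm'
        · have h3 : m < k := hx.lt_iff_lt.1 (by omega)
          have h4 : x (m + 1) ≤ x k := hx.monotone h3
          have h5 : x m < x (m + 1) := hx (Nat.lt_succ_self m)
          omega
      rw [particleWord_of_notMem h2, hwx, h1]
      split_ifs <;> simp_all
  · have h2 := hw2 i hi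
    have hs : ¬ Swaps w i := by
      rw [swaps_iff, h2]; exact fun h => absurd h.1 (not_lt.2 (Fin.le_last _))
    simp only [hs, if_false]
    by_cases hp : ∃ k, x k + 1 = i
    · obtain ⟨k, rfl⟩ := hp
      simp only [hpred (x k + 1) (by omega)]
      have hf : x (k + 1) ≠ x k + 1 := by rwa [succ_mem_range_iff hx] at hi
      have hadv : advance x k = x k + 1 := if_neg hf
      conv_rhs => rw [← hadv]
      have hq : passMark x κ = k ↔ κ = k := by
        rw [passMark_eq_iff fun _ => hf]; tauto
      rw [particleWord_apply hy, Nat.add_sub_cancel, hwx, h2]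
      simp only [eq_comm (a := k), hq]
      by_cases hk : κ = k <;> simp [hk]
    · have h3 : i ∉ Set.range (advance x) := by
        rw [mem_range_advance]
        rintro (⟨m, hm, hm'⟩ | ⟨m, hm, hm'⟩)
        · exact hi ⟨m, hm⟩
        · exact hp ⟨m, hm⟩
      rw [particleWord_of_notMem h3]
      have h4 : w (i - 1) = 2 := by
        rcases Nat.eq_zero_or_pos i with rfl | hi0
        · exact h2
        · exact hw2 _ fun ⟨m, hm⟩ => hp ⟨m, by omega⟩
      have hs' : ¬ Swaps w (i - 1) := by
        rw [swaps_iff, h4]; exact fun h => absurd h.1 (not_lt.2 (Fin.le_last _))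
      rw [if_neg hs', h2]

lemma stepWordTwo_particleWordTwo {x : ℕ → ℕ} (hx : StrictMono x) (h0 : 0 < x 0) :
    stepWordTwo (particleWordTwo x) = particleWordTwo (advance x) := by
  have hpos : ∀ k, 0 < x k := fun k => h0.trans_le (hx.monotone (Nat.zero_le k))
  have h20 : BinaryLetter.two ≠ BinaryLetter.zero := by decide
  funext i
  unfold stepWordTwo
  have key : i ∈ Set.range (advance x) ↔
      (i ∈ Set.range x ∧ i + 1 ∈ Set.range x) ∨ (i - 1 ∈ Set.range x ∧ i ∉ Set.range x) := by
    rw [mem_range_advance]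
    constructor
    · rintro (⟨k, rfl, h⟩ | ⟨k, rfl, h⟩)
      · exact Or.inl ⟨⟨k, rfl⟩, ⟨k + 1, h⟩⟩
      · exact Or.inr ⟨⟨k, by simp⟩, by rwa [succ_mem_range_iff hx]⟩
    · rintro (⟨⟨k, rfl⟩, h⟩ | ⟨⟨k, hk⟩, h⟩)
      · exact Or.inl ⟨k, rfl, (succ_mem_range_iff hx k).1 h⟩
      · have := hpos k
        have hk' : x k + 1 = i := by omega
        subst hk'
        exact Or.inr ⟨k, rfl, by rwa [succ_mem_range_iff hx] at h⟩
  unfold particleWordTwo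
  by_cases h1 : i ∈ Set.range x <;> by_cases h2 : i + 1 ∈ Set.range x <;>
    by_cases h3 : i - 1 ∈ Set.range x <;> simp only [key, h1, h2, h3, h20, h20.symm, if_true,
      if_false, and_true, and_self, not_true, not_false_iff, or_false, or_true, and_false]

lemma advance_iterate_zero_pos {x : ℕ → ℕ} (h0 : 0 < x 0) (t : ℕ) : 0 < (advance^[t] x) 0 := by
  induction t with
  | zero => exact h0
  | succ t ih =>
    rw [Function.iterate_succ_apply', advance]
    split_ifs <;> omega

/-! ### Stabilization times in the particle picture -/

section

variable {n : ℕ} {x : ℕ → ℕ} {κ : ℕ} {ω : Fin n → Letter} {η : Fin n → BinaryLetter}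

lemma pad_step_iterate (hx : StrictMono x) (h0 : 0 < x 0) (hω : pad 2 0 ω = particleWord x κ)
    (t : ℕ) : pad 2 0 (step^[t] ω) = particleWord (advance^[t] x) (markAt x κ t) := by
  induction t with
  | zero => exact hω
  | succ t ih =>
    rw [Function.iterate_succ_apply', pad_step, ih, stepWord_particleWord
      (strictMono_advance_iterate hx t) (advance_iterate_zero_pos h0 t),
      Function.iterate_succ_apply' advance]
    rfl

lemma pad_stepTwo_iterate (hx : StrictMono x) (h0 : 0 < x 0)
    (hη : pad BinaryLetter.two BinaryLetter.zero η = particleWordTwo x) (t : ℕ) :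
    pad BinaryLetter.two BinaryLetter.zero (stepTwo^[t] η) = particleWordTwo (advance^[t] x) := by
  induction t with
  | zero => exact hη
  | succ t ih =>
    rw [Function.iterate_succ_apply', pad_stepTwo, ih, stepWordTwo_particleWordTwo
      (strictMono_advance_iterate hx t) (advance_iterate_zero_pos h0 t),
      Function.iterate_succ_apply' advance]

lemma advance_eq_self_iff : advance x = x ↔ Jammed x 0 := by
  constructor
  · intro h k _
    have := congrFun h k
    unfold advance at this
    split_ifs at this with hb
    · exact hb
    · omega
  · intro h
    funext k
    exact if_pos (h k (Nat.zero_le k))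

lemma stabTimeTwo_eq (hx : StrictMono x) (h0 : 0 < x 0)
    (hη : pad BinaryLetter.two BinaryLetter.zero η = particleWordTwo x) :
    stabTimeTwo η = sInf {t | Jammed (advance^[t] x) 0} := by
  unfold stabTimeTwo
  congr 1
  ext t
  rw [Set.mem_ofPred_eq, Set.mem_ofPred_eq, ← (pad_injective BinaryLetter.two BinaryLetter.zero).eq_iff,
    pad_stepTwo_iterate hx h0 hη, pad_stepTwo_iterate hx h0 hη,
    particleWordTwo_injective (strictMono_advance_iterate hx _) (strictMono_advance_iterate hx _),
    Function.iterate_succ_apply', eq_comm, advance_eq_self_iff]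

lemma jammed_stabTimeTwo (hx : StrictMono x) (h0 : 0 < x 0)
    (hη : pad BinaryLetter.two BinaryLetter.zero η = particleWordTwo x) :
    Jammed (advance^[stabTimeTwo η] x) 0 := by
  obtain ⟨k, hk⟩ := exists_stepTwo_iterate_eq η
  have h : stabTimeTwo η ∈ {k | stepTwo^[k] η = stepTwo^[k + 1] η} := Nat.sInf_mem ⟨k, hk⟩
  rwa [Set.mem_ofPred_eq, ← (pad_injective BinaryLetter.two BinaryLetter.zero).eq_iff,
    pad_stepTwo_iterate hx h0 hη, pad_stepTwo_iterate hx h0 hη,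
    particleWordTwo_injective (strictMono_advance_iterate hx _) (strictMono_advance_iterate hx _),
    Function.iterate_succ_apply', eq_comm, advance_eq_self_iff] at h

/-- In a jam every marked particle with a positive label meets the handover condition. The truncated
subtraction reflects that the mark rests at label 0. -/
lemma markAt_add_of_jammed {T : ℕ} (h : Jammed (advance^[T] x) 0) (i : ℕ) :
    markAt x κ (T + i) = markAt x κ T - i := by
  induction i with
  | zero => rfl
  | succ i ih =>
    change passMark (advance^[T + i] x) (markAt x κ (T + i)) = _
    have hj := h.iterate i
    rw [ih]
    obtain ⟨m, hm0⟩ : ∃ m, m = markAt x κ T - i := ⟨_, rfl⟩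
    rw [← hm0]
    unfold passMark
    have h1 := hj m (Nat.zero_le m)
    have h2 := hj (m - 1) (Nat.zero_le _)
    split_ifs with hc
    · omega
    · rcases Nat.eq_zero_or_pos m with rfl | hm
      · omega
      · rw [show m - 1 + 1 = m by omega] at h2
        exact absurd ⟨hm, h1, h2.symm⟩ hc

/-- The excess is the label of the second class particle at the stabilization time of the
two-letter dynamics. -/
lemma excess_eq_markAt (hx : StrictMono x) (h0 : 0 < x 0) (hω : pad 2 0 ω = particleWord x κ)
    (hη : pad BinaryLetter.two BinaryLetter.zero (fun j => proj (ω j)) = particleWordTwo x) :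
    excess ω = markAt x κ (stabTimeTwo fun j => proj (ω j)) := by
  have hT := jammed_stabTimeTwo hx h0 hη
  have hTeq := stabTimeTwo_eq hx h0 hη
  unfold excess
  generalize (stabTimeTwo fun j => proj (ω j)) = T at *
  suffices stabTime ω = T + markAt x κ T by rw [this]; push_cast; ring
  -- A three-letter word is stationary iff the particles are jammed and the mark does not move;
  -- after the jam the mark rests only at label 0, which it reaches after `markAt x κ T` further
  -- steps.
  have hset : {t | step^[t] ω = step^[t + 1] ω} = Set.Ici (T + markAt x κ T) := by
    ext t
    rw [Set.mem_ofPred_eq, ← (pad_injective 2 0).eq_iff, pad_step_iterate hx h0 hω,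
      pad_step_iterate hx h0 hω, particleWord_injective (strictMono_advance_iterate hx _)
      (strictMono_advance_iterate hx _), Function.iterate_succ_apply', eq_comm,
      advance_eq_self_iff, Set.mem_Ici]
    constructor
    · rintro ⟨h1, h2⟩
      have hTt : T ≤ t := hTeq ▸ Nat.sInf_le h1
      obtain ⟨i, rfl⟩ := Nat.exists_eq_add_of_le hTt
      rw [markAt_add_of_jammed hT, add_assoc, markAt_add_of_jammed hT] at h2
      omega
    · intro h
      obtain ⟨i, rfl⟩ := Nat.exists_eq_add_of_le (show T ≤ t by omega)
      refine ⟨hT.iterate i, ?_⟩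
      rw [markAt_add_of_jammed hT, add_assoc, markAt_add_of_jammed hT]
      omega
  unfold stabTime
  rw [hset, csInf_Ici]

end

/-! ### The excess in terms of the height function of the initial string -/

/-- The height of a list: the number of entries `true` minus the number of entries `false`. -/
def ht (l : List Bool) : ℤ := (l.map fun b => if b then (1 : ℤ) else -1).sum

@[simp] lemma ht_nil : ht [] = 0 := rfl

@[simp] lemma ht_cons_true (l : List Bool) : ht (true :: l) = ht l + 1 := by
  simp [ht, add_comm]

@[simp] lemma ht_cons_false (l : List Bool) : ht (false :: l) = ht l - 1 := by
  simp [ht]; ring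

@[simp] lemma ht_append (l l' : List Bool) : ht (l ++ l') = ht l + ht l' := by
  simp [ht]

/-- The sites, counted from `1`, with entry `true`, together with all sites beyond the list. -/
def zeroSite (l : List Bool) (y : ℕ) : Prop := 0 < y ∧ l[y - 1]? ≠ some false

instance (l : List Bool) : DecidablePred (zeroSite l) := fun y => by
  unfold zeroSite; infer_instance

lemma zeroSite_of_length_lt {l : List Bool} {y : ℕ} (h : l.length < y) : zeroSite l y :=
  ⟨by omega, by rw [List.getElem?_eq_none (by omega)]; simp⟩

lemma infinite_zeroSite (l : List Bool) : (Set.ofPred (zeroSite l)).Infinite :=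
  (Set.Ioi_infinite l.length).mono fun _ hy => zeroSite_of_length_lt hy

/-- The position of the particle with label `k`. -/
noncomputable def particle (l : List Bool) : ℕ → ℕ := Nat.nth (zeroSite l)

lemma strictMono_particle (l : List Bool) : StrictMono (particle l) :=
  Nat.nth_strictMono (infinite_zeroSite l)

lemma mem_range_particle {l : List Bool} {y : ℕ} : y ∈ Set.range (particle l) ↔ zeroSite l y := by
  have := Nat.range_nth_of_infinite (infinite_zeroSite l)
  unfold particle
  rw [this]; rfl

lemma particle_zero_pos (l : List Bool) : 0 < particle l 0 :=
  (mem_range_particle.1 ⟨0, rfl⟩ : zeroSite l _).1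

lemma two_mul_count_zeroSite {l : List Bool} {y : ℕ} (hy : y ≤ l.length) :
    2 * (Nat.count (zeroSite l) (y + 1) : ℤ) = ht (l.take y) + y := by
  induction y with
  | zero => simp [Nat.count_succ, show ¬ zeroSite l 0 from fun h => lt_irrefl _ h.1]
  | succ y ih =>
    have ih' := ih (by omega)
    rw [Nat.count_succ, List.take_succ_eq_append_getElem hy, ht_append]
    have h : zeroSite l (y + 1) ↔ l[y] = true := by
      simp [zeroSite, List.getElem?_eq_getElem hy]
    simp only [h]
    cases l[y] <;> simp <;> linarith

/-- The dictionary between particles and walk: a low value of `x k - 2 k` is a large height. -/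
lemma ht_take_particle {l : List Bool} {k : ℕ} (h : particle l k ≤ l.length) :
    ht (l.take (particle l k)) = 2 * (k + 1) - particle l k := by
  have h1 := two_mul_count_zeroSite h
  have h2 : Nat.count (zeroSite l) (particle l k + 1) = k + 1 :=
    Nat.count_nth_succ_of_infinite (infinite_zeroSite l) k
  rw [h2] at h1
  push_cast at h1
  linarith

lemma Jammed.zeroSite {l : List Bool} {k y : ℕ} (h : Jammed (particle l) k)
    (hy : particle l k ≤ y) : zeroSite l y := by
  obtain ⟨m, rfl⟩ := Nat.exists_eq_add_of_le hy
  have : particle l (k + m) = particle l k + m := by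
    clear hy
    induction m with
    | zero => rfl
    | succ m ih => rw [← add_assoc, h (k + m) (by omega), ih]; rfl
  exact mem_range_particle.1 ⟨_, this⟩

lemma jammed_of_length_lt {l : List Bool} {k : ℕ} (h : l.length < particle l k) :
    Jammed (particle l) k := by
  intro i hi
  rw [← succ_mem_range_iff (strictMono_particle l), mem_range_particle]
  exact zeroSite_of_length_lt (by have := (strictMono_particle l).monotone hi; omega)

/-! ### Deterministic criteria for excess one and excess zero -/

section

variable {n : ℕ} {ω : Fin n → Letter} {i : Fin n}

lemma zeroSite_ofFn_succ (j : Fin n) :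
    zeroSite (List.ofFn fun j => decide (ω j ≠ 2)) (j + 1) ↔ ω j ≠ 2 := by
  simp [zeroSite]

/-- Sites are counted from one, so the letter 1 at index `i` is the particle at site `i + 1`. -/
lemma exists_pad_eq (h1 : ω i = 1) (h2 : ∀ j ≠ i, ω j ≠ 1) :
    ∃ κ, particle (List.ofFn fun j => decide (ω j ≠ 2)) κ = i + 1 ∧
      pad 2 0 ω = particleWord (particle (List.ofFn fun j => decide (ω j ≠ 2))) κ ∧
      pad BinaryLetter.two BinaryLetter.zero (fun j => proj (ω j)) =
        particleWordTwo (particle (List.ofFn fun j => decide (ω j ≠ 2))) := by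
  set l := List.ofFn fun j => decide (ω j ≠ 2) with hl
  have hlen : l.length = n := by simp [hl]
  obtain ⟨κ, hκ⟩ : (i : ℕ) + 1 ∈ Set.range (particle l) := by
    rw [mem_range_particle, zeroSite_ofFn_succ, h1]; decide
  refine ⟨κ, hκ, ?_, ?_⟩ <;> funext y <;> rcases Nat.eq_zero_or_pos y with rfl | hy
  · have : 0 ∉ Set.range (particle l) := by rw [mem_range_particle]; simp [zeroSite]
    rw [particleWord_of_notMem this]; rfl
  · rcases Nat.lt_or_ge n y with hn | hn
    · have h3 : y ≠ i + 1 := by omega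
      have h4 : zeroSite l y := zeroSite_of_length_lt (by omega)
      rw [pad_of_lt _ _ _ hn, particleWord, hκ, if_neg h3, if_pos (mem_range_particle.2 h4)]
    · obtain ⟨j, rfl⟩ : ∃ j : Fin n, y = j + 1 := ⟨⟨y - 1, by omega⟩, by simp; omega⟩
      rw [pad_succ]
      by_cases hj : j = i
      · subst hj; rw [particleWord, hκ, if_pos rfl, h1]
      · have h3 : (j : ℕ) + 1 ≠ i + 1 := fun h => hj (Fin.ext (by omega))
        rw [particleWord, hκ, if_neg h3]
        have h4 := h2 j hj
        have h5 := zeroSite_ofFn_succ (ω := ω) j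
        rw [← hl, ← mem_range_particle] at h5
        split_ifs with h
        · have h6 := h5.1 h
          generalize ω j = a at h4 h6 ⊢
          revert a; decide
        · have := not_not.1 (mt h5.2 h)
          exact this
  · have : 0 ∉ Set.range (particle l) := by rw [mem_range_particle]; simp [zeroSite]
    rw [particleWordTwo_eq_two_iff.2 this]; rfl
  · rcases Nat.lt_or_ge n y with hn | hn
    · have h4 : zeroSite l y := zeroSite_of_length_lt (by omega)
      rw [pad_of_lt _ _ _ hn, particleWordTwo, if_pos (mem_range_particle.2 h4)]
    · obtain ⟨j, rfl⟩ : ∃ j : Fin n, y = j + 1 := ⟨⟨y - 1, by omega⟩, by simp; omega⟩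
      rw [pad_succ, particleWordTwo, proj]
      have h5 := zeroSite_ofFn_succ (ω := ω) j
      rw [← hl, ← mem_range_particle] at h5
      simp only [h5]
      split_ifs <;> simp_all

/-- A full jam at time `k` traces back to a jam of all labels from `k` on at time 0. -/
lemma lt_stabTime_of_not_jammed {x : ℕ → ℕ} (hx : StrictMono x) {k T : ℕ}
    (hT : Jammed (advance^[T] x) 0) (h : ¬ Jammed x k) : k < T := by
  by_contra hle
  exact h ((hT.iterate_le (not_lt.1 hle)).of_iterate hx)

/-- The excess is `1` if some `0` to the left of the second class particle is at a height which is
not exceeded further to the right. -/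
theorem excess_eq_one (h1 : ω i = 1) (h2 : ∀ j ≠ i, ω j ≠ 1) {l : List Bool}
    (hl : l = List.ofFn fun j => decide (ω j ≠ 2)) {X : ℕ} (hX : X ≤ i) (hX0 : zeroSite l X)
    (hXmax : ∀ y, X < y → y ≤ n → zeroSite l y → ht (l.take y) ≤ ht (l.take X))
    (htwo : ∃ y, (i : ℕ) + 1 < y ∧ ¬ zeroSite l y) : excess ω = 1 := by
  obtain ⟨κ, hκ, hω, hη⟩ := exists_pad_eq h1 h2
  rw [← hl] at hκ hω hη
  have hlen : l.length = n := by simp [hl]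
  have hx := strictMono_particle l
  have h0 := particle_zero_pos l
  rw [excess_eq_markAt hx h0 hω hη]
  have hT := jammed_stabTimeTwo hx h0 hη
  have hTeq := stabTimeTwo_eq hx h0 hη
  generalize (stabTimeTwo fun j => proj (ω j)) = T at *
  obtain ⟨j, rfl⟩ := mem_range_particle.2 hX0
  have hjκ : j < κ := hx.lt_iff_lt.1 (by omega)
  have hin := i.2
  have hnj : ¬ Jammed (particle l) κ := fun h => by
    obtain ⟨y, hy, hy'⟩ := htwo
    exact hy' (h.zeroSite (by omega))
  have hκT := lt_stabTime_of_not_jammed hx hT hnj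
  -- Particle 0 is blocked at the times `T` and `T + 1`, so the mark has label 0 at time `T + 1` and
  -- at most 1 one step earlier.
  have hup : markAt (particle l) κ T ≤ 1 := by
    have e := markAt_eq_zero hx (k := κ) (s := T) (by omega) (hT 0 le_rfl)
      ((hT.iterate 1) 0 le_rfl)
    have := le_passMark_add_one (advance^[T] (particle l)) (markAt (particle l) κ T)
    change passMark _ _ = 0 at e
    omega
  -- Label 0 at time `T` would require all particles to be jammed strictly before `T`, against the
  -- minimality of `T`.
  have hlow : markAt (particle l) κ T ≠ 0 := by
    intro hz
    have hfree : ∀ k, j ≤ k →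
        particle l j + 2 * k ≤ particle l k + 2 * j ∨ Jammed (particle l) k := by
      intro k hk
      rcases hk.lt_or_eq with hk | rfl
      · rcases Nat.lt_or_ge n (particle l k) with hn | hn
        · exact Or.inr (jammed_of_length_lt (by omega))
        · left
          have := hXmax _ (hx hk) hn (mem_range_particle.1 ⟨k, rfl⟩)
          rw [ht_take_particle (by omega), ht_take_particle (by omega)] at this
          omega
      · exact Or.inl le_rfl
    obtain ⟨s, hs, hj⟩ := jammed_of_markAt_le hjκ
      (fun t ht => Jammed.of_blocked_of_free hx hfree ht) T 0 (Nat.zero_le _) hz.le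
    have := Nat.sInf_le (s := {t | Jammed (advance^[t] (particle l)) 0}) hj
    omega
  have : markAt (particle l) κ T = 1 := by omega
  rw [this]; rfl

/-- The excess is `0` if to the right of the second class particle there are two consecutive `0`s
at new strict record heights, with a `2` further to the right. -/
theorem excess_eq_zero (h1 : ω i = 1) (h2 : ∀ j ≠ i, ω j ≠ 1) {l : List Bool}
    (hl : l = List.ofFn fun j => decide (ω j ≠ 2)) {y : ℕ} (hy : (i : ℕ) < y)
    (hy0 : zeroSite l y) (hy1 : zeroSite l (y + 1))
    (hrec : ∀ z < y, ht (l.take z) < ht (l.take y))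
    (htwo : ∃ y', y + 1 < y' ∧ ¬ zeroSite l y') : excess ω = 0 := by
  obtain ⟨κ, hκ, hω, hη⟩ := exists_pad_eq h1 h2
  rw [← hl] at hκ hω hη
  have hlen : l.length = n := by simp [hl]
  have hx := strictMono_particle l
  have h0 := particle_zero_pos l
  rw [excess_eq_markAt hx h0 hω hη]
  have hT := jammed_stabTimeTwo hx h0 hη
  generalize (stabTimeTwo fun j => proj (ω j)) = T at *
  obtain ⟨s, rfl⟩ := mem_range_particle.2 hy0
  have hs1 : particle l (s + 1) = particle l s + 1 := by
    rwa [← succ_mem_range_iff hx, mem_range_particle]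
  obtain ⟨y', hy', hy'2⟩ := htwo
  have hlt : y' ≤ l.length := by
    by_contra h
    exact hy'2 (zeroSite_of_length_lt (by omega))
  have hκs : κ ≤ s := hx.le_iff_le.1 (by omega)
  have hsT := lt_stabTime_of_not_jammed hx hT (k := s) fun h => hy'2 (h.zeroSite (by omega))
  have hr : ∀ m < s, particle l s + 2 * m < particle l m + 2 * s := by
    intro m hm
    have := hrec _ (hx hm)
    have hms := hx hm
    rw [ht_take_particle (by omega), ht_take_particle (by omega)] at this
    omega
  -- Labels `s` and `s + 1` are both strict records, so particle 0 is blocked at the times `s - 1`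
  -- and `s`. For `s = 0` the mark starts at label 0.
  have hzero : markAt (particle l) κ s = 0 := by
    rcases s with _ | s
    · exact Nat.le_zero.1 hκs
    · apply markAt_eq_zero hx hκs (blocked_zero_of_record hx hr) (blocked_zero_of_record hx _)
      intro m hm
      rcases Nat.lt_or_ge m (s + 1) with h | h
      · have := hr m h; omega
      · obtain rfl : m = s + 1 := by omega
        omega
  have := markAt_anti (particle l) κ hsT.le
  rw [hzero] at this
  simpa using this

end

/-! ### Expectations over lists of independent coin tosses -/

/-- The expectation of `F` over lists of `n` independent entries which are `true` with
probability `q`. -/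
def bernExp (q : ℝ) : ℕ → (List Bool → ℝ) → ℝ
  | 0, F => F []
  | n + 1, F => q * bernExp q n (fun l => F (true :: l)) +
      (1 - q) * bernExp q n (fun l => F (false :: l))

open Classical in
/-- The probability of `A` for a list of `n` independent entries which are `true` with
probability `q`. -/
noncomputable def bernProb (q : ℝ) (n : ℕ) (A : List Bool → Prop) : ℝ :=
  bernExp q n fun l => if A l then 1 else 0

section

variable {q : ℝ} {m n : ℕ} {F G : List Bool → ℝ} {A B : List Bool → Prop}

lemma bernExp_congr (h : ∀ l : List Bool, l.length = n → F l = G l) :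
    bernExp q n F = bernExp q n G := by
  induction n generalizing F G with
  | zero => exact h _ rfl
  | succ n ih =>
    simp only [bernExp]
    rw [ih fun l hl => h (true :: l) (by simp [hl]), ih fun l hl => h (false :: l) (by simp [hl])]

lemma bernExp_mono (h0 : 0 ≤ q) (h1 : q ≤ 1) (h : ∀ l : List Bool, l.length = n → F l ≤ G l) :
    bernExp q n F ≤ bernExp q n G := by
  induction n generalizing F G with
  | zero => exact h _ rfl
  | succ n ih =>
    have h1' : 0 ≤ 1 - q := by linarith
    exact add_le_add
      (mul_le_mul_of_nonneg_left (ih fun l hl => h (true :: l) (by simp [hl])) h0)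
      (mul_le_mul_of_nonneg_left (ih fun l hl => h (false :: l) (by simp [hl])) h1')

lemma bernExp_add : bernExp q n (fun l => F l + G l) = bernExp q n F + bernExp q n G := by
  induction n generalizing F G with
  | zero => rfl
  | succ n ih => simp only [bernExp, ih]; ring

lemma bernExp_const_mul (c : ℝ) : bernExp q n (fun l => c * F l) = c * bernExp q n F := by
  induction n generalizing F with
  | zero => rfl
  | succ n ih => simp only [bernExp, ih]; ring

lemma bernExp_const (c : ℝ) : bernExp q n (fun _ => c) = c := by
  induction n with
  | zero => rfl
  | succ n ih => simp only [bernExp, ih]; ring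

lemma bernExp_sub : bernExp q n (fun l => F l - G l) = bernExp q n F - bernExp q n G := by
  induction n generalizing F G with
  | zero => rfl
  | succ n ih => simp only [bernExp, ih]; ring

lemma bernExp_sum {ι : Type*} (s : Finset ι) (H : ι → List Bool → ℝ) :
    bernExp q n (fun l => ∑ i ∈ s, H i l) = ∑ i ∈ s, bernExp q n (H i) := by
  classical
  induction s using Finset.induction_on with
  | empty => simpa using bernExp_const (q := q) (n := n) 0
  | insert a s ha ih => simp only [Finset.sum_insert ha]; rw [bernExp_add, ih]

lemma bernExp_append :
    bernExp q (m + n) F = bernExp q m fun a => bernExp q n fun b => F (a ++ b) := by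
  induction m generalizing F with
  | zero => simp [bernExp]
  | succ m ih => rw [Nat.succ_add]; simp only [bernExp, ih, List.cons_append]

lemma bernExp_succ_concat : bernExp q (n + 1) F =
    q * bernExp q n (fun l => F (l ++ [true])) + (1 - q) * bernExp q n (fun l => F (l ++ [false])) := by
  rw [bernExp_append]
  simp only [bernExp]
  rw [bernExp_add, bernExp_const_mul, bernExp_const_mul]

lemma bernExp_reverse : bernExp q n (fun l => F l.reverse) = bernExp q n F := by
  induction n generalizing F with
  | zero => rfl
  | succ n ih =>
    rw [bernExp_succ_concat (F := F)]
    simp only [bernExp, List.reverse_cons]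
    rw [ih (F := fun l => F (l ++ [true])), ih (F := fun l => F (l ++ [false]))]

lemma bernExp_map_not : bernExp (1 / 2) n (fun l => F (l.map (!·))) = bernExp (1 / 2) n F := by
  induction n generalizing F with
  | zero => rfl
  | succ n ih =>
    simp only [bernExp, List.map_cons, Bool.not_true, Bool.not_false]
    rw [ih (F := fun l => F (true :: l)), ih (F := fun l => F (false :: l))]
    ring

lemma bernExp_zpow_ht {z : ℝ} (hz : z ≠ 0) :
    bernExp q n (fun l => z ^ ht l) = (q * z + (1 - q) / z) ^ n := by
  induction n with
  | zero => simp [bernExp]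
  | succ n ih =>
    simp only [bernExp, ht_cons_true, ht_cons_false, zpow_add_one₀ hz, zpow_sub_one₀ hz]
    simp only [mul_comm _ z, mul_comm _ z⁻¹]
    rw [bernExp_const_mul, bernExp_const_mul, ih]
    ring

lemma bernExp_nonneg (h0 : 0 ≤ q) (h1 : q ≤ 1) (h : ∀ l : List Bool, l.length = n → 0 ≤ F l) :
    0 ≤ bernExp q n F := by
  rw [← bernExp_const (q := q) (n := n) 0]; exact bernExp_mono h0 h1 h

lemma bernProb_nonneg (h0 : 0 ≤ q) (h1 : q ≤ 1) : 0 ≤ bernProb q n A :=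
  bernExp_nonneg h0 h1 fun l _ => by split_ifs <;> norm_num

lemma bernProb_mono (h0 : 0 ≤ q) (h1 : q ≤ 1) (h : ∀ l : List Bool, l.length = n → A l → B l) :
    bernProb q n A ≤ bernProb q n B := by
  classical
  refine bernExp_mono h0 h1 fun l hl => ?_
  have := h l hl
  by_cases hA : A l
  · simp [hA, this hA]
  · simp only [hA, if_false]; split_ifs <;> norm_num

lemma bernProb_congr (h : ∀ l : List Bool, l.length = n → (A l ↔ B l)) :
    bernProb q n A = bernProb q n B :=
  bernExp_congr fun l hl => by
    by_cases hA : A l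
    · simp [hA, (h l hl).1 hA]
    · simp [hA, mt (h l hl).2 hA]

lemma bernProb_le_one (h0 : 0 ≤ q) (h1 : q ≤ 1) : bernProb q n A ≤ 1 := by
  rw [← bernExp_const (q := q) (n := n) 1]
  exact bernExp_mono h0 h1 fun l _ => by split_ifs <;> norm_num

lemma bernProb_not : bernProb q n (fun l => ¬ A l) = 1 - bernProb q n A := by
  rw [← bernExp_const (q := q) (n := n) 1, bernProb, bernProb, ← bernExp_sub]
  exact bernExp_congr fun l _ => by by_cases h : A l <;> simp [h]

lemma bernProb_or_le (h0 : 0 ≤ q) (h1 : q ≤ 1) :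
    bernProb q n (fun l => A l ∨ B l) ≤ bernProb q n A + bernProb q n B := by
  classical
  rw [bernProb, bernProb, bernProb, ← bernExp_add]
  refine bernExp_mono h0 h1 fun l _ => ?_
  by_cases hA : A l <;> by_cases hB : B l <;> simp [hA, hB]

lemma bernProb_exists_le (h0 : 0 ≤ q) (h1 : q ≤ 1) {ι : Type*} (s : Finset ι)
    (C : ι → List Bool → Prop) :
    bernProb q n (fun l => ∃ i ∈ s, C i l) ≤ ∑ i ∈ s, bernProb q n (C i) := by
  classical
  simp only [bernProb]
  rw [← bernExp_sum]
  refine bernExp_mono h0 h1 fun l _ => ?_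
  have hnn : ∀ i ∈ s, (0 : ℝ) ≤ if C i l then 1 else 0 := fun i _ => by split_ifs <;> norm_num
  split_ifs with h
  · obtain ⟨i, hi, hC⟩ := h
    calc (1 : ℝ) = if C i l then 1 else 0 := by simp [hC]
      _ ≤ _ := Finset.single_le_sum hnn hi
  · exact Finset.sum_nonneg hnn

lemma bernProb_append :
    bernProb q (m + n) A = bernExp q m fun a => bernProb q n fun b => A (a ++ b) :=
  bernExp_append

lemma bernProb_succ : bernProb q (n + 1) A =
    q * bernProb q n (fun l => A (true :: l)) + (1 - q) * bernProb q n (fun l => A (false :: l)) :=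
  rfl

lemma bernProb_append_le {c : ℝ} (h0 : 0 ≤ q) (h1 : q ≤ 1)
    (h : ∀ a : List Bool, a.length = m → bernProb q n (fun b => A (a ++ b)) ≤ c) :
    bernProb q (m + n) A ≤ c := by
  rw [bernProb_append, ← bernExp_const (q := q) (n := m) c]
  exact bernExp_mono h0 h1 h

lemma bernProb_eq_zero (h : ∀ l : List Bool, l.length = n → ¬ A l) : bernProb q n A = 0 := by
  rw [← bernExp_const (q := q) (n := n) 0]
  exact bernExp_congr fun l hl => by simp [h l hl]

/-- The probability of an event for the prefix of length `m`. -/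
lemma bernProb_take : bernProb q (m + n) (fun l => A (l.take m)) = bernProb q m A := by
  rw [bernProb_append]
  refine bernExp_congr fun a ha => ?_
  have : ∀ b : List Bool, (a ++ b).take m = a := fun b => by
    rw [← ha, List.take_left]
  simp only [this]
  exact bernExp_const _

/-- The probability of an event for the suffix of length `n`. -/
lemma bernProb_drop : bernProb q (m + n) (fun l => A (l.drop m)) = bernProb q n A := by
  rw [bernProb_append, ← bernExp_const (q := q) (n := m) (bernProb q n A)]
  refine bernExp_congr fun a ha => ?_
  have : ∀ b : List Bool, (a ++ b).drop m = b := fun b => by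
    rw [← ha, List.drop_left]
  simp only [this]

end

/-! ### Double records -/

/-- There are two consecutive steps up, the first of which reaches a strict record height which
exceeds `d`. -/
def DoubleRecord (d : ℤ) (l : List Bool) : Prop :=
  ∃ a b, l = a ++ true :: true :: b ∧ d ≤ ht a ∧ ∀ a', a' <+: a → ht a' ≤ ht a

namespace DoubleRecord

variable {d e : ℤ} {l : List Bool}

lemma append (h : DoubleRecord d l) (l' : List Bool) : DoubleRecord d (l ++ l') := by
  obtain ⟨a, b, rfl, h1, h2⟩ := h
  exact ⟨a, b ++ l', by simp, h1, h2⟩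

lemma mono (h : DoubleRecord d l) (hde : e ≤ d) : DoubleRecord e l := by
  obtain ⟨a, b, rfl, h1, h2⟩ := h
  exact ⟨a, b, rfl, hde.trans h1, h2⟩

lemma cons_true (h : DoubleRecord d l) : DoubleRecord (d + 1) (true :: l) := by
  obtain ⟨a, b, rfl, h1, h2⟩ := h
  refine ⟨true :: a, b, rfl, by simpa using h1, fun a' ha' => ?_⟩
  rw [List.prefix_cons_iff] at ha'
  obtain rfl | ⟨a'', rfl, ha''⟩ := ha'
  · have := h2 [] List.nil_prefix
    simp at this ⊢; omega
  · simpa using h2 a'' ha''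

/-- The hypothesis `0 ≤ d` keeps the new starting point, which lies one higher than the old one,
from exceeding the record. -/
lemma cons_false (h : DoubleRecord (d + 1) l) (hd : 0 ≤ d) : DoubleRecord d (false :: l) := by
  obtain ⟨a, b, rfl, h1, h2⟩ := h
  refine ⟨false :: a, b, rfl, by simp; omega, fun a' ha' => ?_⟩
  rw [List.prefix_cons_iff] at ha'
  obtain rfl | ⟨a'', rfl, ha''⟩ := ha'
  · simp; omega
  · simpa using h2 a'' ha''

lemma cons_cons_true : DoubleRecord 0 (true :: true :: l) :=
  ⟨[], l, rfl, by simp, fun a' ha' => by rw [List.prefix_nil.1 ha']⟩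

end DoubleRecord

section

variable {q : ℝ}

/-- Condition on the first step, which lowers or raises the remaining climb by one. -/
lemma bernProb_not_doubleRecord_succ (h0 : 0 ≤ q) (h1 : q ≤ 1) (n d : ℕ) :
    bernProb q (n + 1) (fun l => ¬ DoubleRecord (d + 1 : ℕ) l) ≤
      q * bernProb q n (fun l => ¬ DoubleRecord d l) +
        (1 - q) * bernProb q n (fun l => ¬ DoubleRecord (d + 2 : ℕ) l) := by
  have h1' : 0 ≤ 1 - q := by linarith
  rw [bernProb_succ]
  gcongr
  · refine bernProb_mono h0 h1 fun l _ h => ?_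
    contrapose! h
    exact_mod_cast h.cons_true
  · refine bernProb_mono h0 h1 fun l _ h => ?_
    contrapose! h
    refine DoubleRecord.cons_false ?_ (by positivity)
    exact_mod_cast h

lemma bernProb_not_doubleRecord_antitone (h0 : 0 ≤ q) (h1 : q ≤ 1) (d : ℤ) :
    Antitone fun n => bernProb q n (fun l => ¬ DoubleRecord d l) := by
  intro m n hmn
  obtain ⟨k, rfl⟩ := Nat.exists_eq_add_of_le hmn
  dsimp only
  rw [← bernProb_take (m := m) (n := k)]
  refine bernProb_mono h0 h1 fun l _ h => ?_
  contrapose! h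
  rw [← List.take_append_drop m l]
  exact h.append _

/-- Two immediate steps up succeed, with probability `q * q ≥ 1 / 4`. Every other beginning leaves
the walk one below its running maximum after at most two steps. -/
lemma bernProb_not_doubleRecord_zero (h0 : 1 / 2 ≤ q) (h1 : q ≤ 1) (n : ℕ) :
    bernProb q (n + 2) (fun l => ¬ DoubleRecord 0 l) ≤
      3 / 4 * bernProb q n (fun l => ¬ DoubleRecord (1 : ℕ) l) := by
  have h0' : 0 ≤ q := by linarith
  have h1' : 0 ≤ 1 - q := by linarith
  have e1 : bernProb q n (fun l => ¬ DoubleRecord 0 (true :: true :: l)) = 0 :=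
    bernProb_eq_zero fun l _ h => h DoubleRecord.cons_cons_true
  have e2 : bernProb q n (fun l => ¬ DoubleRecord 0 (true :: false :: l)) ≤
      bernProb q n (fun l => ¬ DoubleRecord (1 : ℕ) l) := by
    refine bernProb_mono h0' h1 fun l _ h => ?_
    contrapose! h
    exact (DoubleRecord.cons_false (d := 0) (by simpa using h) le_rfl).cons_true.mono (by simp)
  have e3 : bernProb q (n + 1) (fun l => ¬ DoubleRecord 0 (false :: l)) ≤
      bernProb q n (fun l => ¬ DoubleRecord (1 : ℕ) l) := by
    refine le_trans ?_ (bernProb_not_doubleRecord_antitone h0' h1 _ (Nat.le_succ n))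
    refine bernProb_mono h0' h1 fun l _ h => ?_
    contrapose! h
    exact DoubleRecord.cons_false (d := 0) (by simpa using h) le_rfl
  have e4 : 0 ≤ bernProb q n (fun l => ¬ DoubleRecord (1 : ℕ) l) := bernProb_nonneg h0' h1
  rw [bernProb_succ, bernProb_succ, e1]
  generalize bernProb q n (fun l => ¬ DoubleRecord (1 : ℕ) l) = v at *
  calc _ ≤ q * (q * 0 + (1 - q) * v) + (1 - q) * v := by gcongr
    _ = (1 - q * q) * v := by ring
    _ ≤ _ := by
      apply mul_le_mul_of_nonneg_right _ e4
      nlinarith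

/-- For an upward drift, a double record is missing with small probability. -/
lemma mul_bernProb_not_doubleRecord_le (h0 : 1 / 2 ≤ q) (h1 : q ≤ 1) {R : ℕ} (hR : 0 < R)
    (n : ℕ) : ∀ d ≤ R, n * bernProb q n (fun l => ¬ DoubleRecord d l) ≤
      ((n : ℝ) / R + R + 3) * (d + 3) + (d + 3) * (R - d) := by
  have h0' : 0 ≤ q := by linarith
  have h1' : 0 ≤ 1 - q := by linarith
  have hRr : (0 : ℝ) < R := by exact_mod_cast hR
  have hR1 : (1 : ℝ) ≤ R := by exact_mod_cast hR
  -- The right side is a supersolution for the remaining climb `d`. The linear factor `d + 3` fits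
  -- the boundary inequality, as `3 / 4 * (1 + 3) = 0 + 3`. The average of `(d + 3) * (R - d)` over
  -- the two neighbours of a point is smaller by one than its value there, which pays for the factor
  -- `n` growing by one. At `d = R` the term with `n / R` makes the bound trivial.
  induction n using Nat.strong_induction_on with
  | _ n ih =>
  intro d hd
  have hdr : (d : ℝ) ≤ R := by exact_mod_cast hd
  have hv := bernProb_le_one (q := q) (n := n) (A := fun l => ¬ DoubleRecord d l) h0' h1
  rcases n with _ | n
  · simp only [Nat.cast_zero, zero_mul, zero_div, zero_add]
    have : (0 : ℝ) ≤ R - d := by linarith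
    positivity
  have hn0 : (0 : ℝ) ≤ (n : ℝ) / R := by positivity
  have hnR : (n : ℝ) = (n : ℝ) / R * R := by field_simp
  have hnn : ((n + 1 : ℕ) : ℝ) / R = (n : ℝ) / R + 1 / R := by push_cast; ring
  have h1R : (1 : ℝ) = 1 / R * R := by field_simp
  have h1R0 : (0 : ℝ) ≤ 1 / R := by positivity
  rcases hd.lt_or_eq with hlt | rfl
  · rcases d with _ | d
    · rcases n with _ | n
      · simp only [zero_add, Nat.cast_one, one_mul, Nat.cast_zero] at hv ⊢
        nlinarith
      · have key := bernProb_not_doubleRecord_zero h0 h1 n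
        have hi := ih n (by omega) 1 (by omega)
        have hv0 : bernProb q n (fun l => ¬ DoubleRecord (1 : ℕ) l) ≤ 1 := bernProb_le_one h0' h1
        have hq : ((n + 1 + 1 : ℕ) : ℝ) / R = (n : ℝ) / R + 2 / R := by push_cast; ring
        have h2R : (0 : ℝ) ≤ 2 / R := by positivity
        have hle := mul_le_mul_of_nonneg_left key (show (0 : ℝ) ≤ n + 2 by positivity)
        rw [hq]
        push_cast at hi hle ⊢
        generalize bernProb q n (fun l => ¬ DoubleRecord 1 l) = v at *
        generalize bernProb q (n + 2) (fun l => ¬ DoubleRecord 0 l) = w at *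
        nlinarith
    · have key := bernProb_not_doubleRecord_succ h0' h1 n d
      have hi1 := ih n (by omega) d (by omega)
      have hi2 := ih n (by omega) (d + 2) (by omega)
      have hle := mul_le_mul_of_nonneg_left key (show (0 : ℝ) ≤ n by positivity)
      rw [hnn]
      push_cast at hi1 hi2 hle hv hdr ⊢
      generalize bernProb q n (fun l => ¬ DoubleRecord d l) = v1 at *
      generalize bernProb q n (fun l => ¬ DoubleRecord (d + 2) l) = v2 at *
      generalize bernProb q (n + 1) (fun l => ¬ DoubleRecord (d + 1) l) = w at *
      generalize (n : ℝ) / R = M at *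
      set F1 := (M + R + 3) * ((d : ℝ) + 3) + (d + 3) * (R - d) with hF1
      set F2 := (M + R + 3) * ((d : ℝ) + 2 + 3) + (d + 2 + 3) * (R - (d + 2)) with hF2
      -- Since the bound grows with `d`, the assumption `q ≥ 1 / 2` reduces the weighted average to
      -- the symmetric one.
      have hF : F1 ≤ F2 := by rw [hF1, hF2]; nlinarith
      have hc : q * F1 + (1 - q) * F2 ≤ (F1 + F2) / 2 := by nlinarith
      have h3 : n * (q * v1 + (1 - q) * v2) ≤ q * F1 + (1 - q) * F2 := by
        have := mul_le_mul_of_nonneg_left hi1 h0'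
        have := mul_le_mul_of_nonneg_left hi2 h1'
        linarith
      have h4 : 0 ≤ 1 / (R : ℝ) * (d + 1 + 3) := by positivity
      have h5 : (F1 + F2) / 2 = (M + R + 3) * ((d : ℝ) + 1 + 3) + (d + 1 + 3) * (R - (d + 1)) - 1 := by
        rw [hF1, hF2]; ring
      nlinarith
  · have : ((n + 1 : ℕ) : ℝ) * bernProb q (n + 1) (fun l => ¬ DoubleRecord d l) ≤ (n + 1 : ℕ) * 1 := by
      gcongr
    rw [hnn]
    push_cast at this ⊢
    nlinarith

lemma tendsto_bernProb_not_doubleRecord (h0 : 1 / 2 ≤ q) (h1 : q ≤ 1) :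
    Tendsto (fun n => bernProb q n (fun l => ¬ DoubleRecord 0 l)) atTop (nhds 0) := by
  have h0' : 0 ≤ q := by linarith
  rw [Metric.tendsto_atTop]
  intro ε hε
  -- At `d = 0` the bound reads `3 * n / R + 6 * R + 9`; `R` and then `N` make each part less than
  -- `n * ε / 2`.
  obtain ⟨R, hR⟩ := exists_nat_gt (6 / ε)
  have hR0 : (0 : ℝ) < R := lt_trans (by positivity) hR
  have hR' : 0 < R := by exact_mod_cast hR0
  obtain ⟨N, hN⟩ := exists_nat_gt ((6 * R + 9) / (ε / 2))
  refine ⟨N, fun n hn => ?_⟩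
  have hNn : (N : ℝ) ≤ n := by exact_mod_cast hn
  have hn0 : (0 : ℝ) < n := lt_of_lt_of_le (lt_trans (by positivity) hN) hNn
  have := mul_bernProb_not_doubleRecord_le h0 h1 hR' n 0 (Nat.zero_le R)
  have hv : 0 ≤ bernProb q n (fun l => ¬ DoubleRecord 0 l) := bernProb_nonneg h0' h1
  rw [Real.dist_eq, sub_zero, abs_of_nonneg hv]
  rw [div_lt_iff₀ (by positivity)] at hN hR
  have h3 : (n : ℝ) / R < n * (ε / 6) := by
    rw [div_lt_iff₀ hR0]; nlinarith
  push_cast at this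
  have h4 : (n : ℝ) * bernProb q n (fun l => ¬ DoubleRecord 0 l) < n * ε := by nlinarith
  exact lt_of_mul_lt_mul_left h4 hn0.le

/-- Once the height `d` is reached at least `K` steps before the end, a double record is missing
with small probability. -/
lemma bernProb_reach_not_doubleRecord_le (h0 : 0 ≤ q) (h1 : q ≤ 1) {n K : ℕ} (hK : K ≤ n)
    (d : ℕ) :
    bernProb q n (fun l => ¬ DoubleRecord d l ∧
        ∃ l', l' <+: l ∧ l'.length + K ≤ n ∧ (d : ℤ) ≤ ht l') ≤
      bernProb q K (fun l => ¬ DoubleRecord 0 l) := by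
  have h1' : 0 ≤ 1 - q := by linarith
  -- Step by step, this is the Markov property at the first visit to height `d`: at least `K` steps
  -- then remain, and further steps only help.
  induction n generalizing d with
  | zero =>
    obtain rfl := Nat.le_zero.1 hK
    refine bernProb_mono h0 h1 fun l hl h => ?_
    obtain rfl := List.length_eq_zero_iff.1 hl
    rintro ⟨a, b, hab, -⟩
    simp at hab
  | succ n ih =>
    rcases d with _ | d
    · refine le_trans ?_ (bernProb_not_doubleRecord_antitone h0 h1 0 hK)
      exact bernProb_mono h0 h1 fun l _ h => by simpa using h.1
    rcases hK.lt_or_eq with hlt | rfl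
    · have hK' : K ≤ n := by omega
      rw [bernProb_succ]
      have e1 := ih hK' d
      have e2 := ih hK' (d + 2)
      calc _ ≤ q * bernProb q K (fun l => ¬ DoubleRecord 0 l) +
            (1 - q) * bernProb q K (fun l => ¬ DoubleRecord 0 l) := by
            gcongr
            · refine le_trans (bernProb_mono h0 h1 ?_) e1
              rintro l - ⟨hl1, l', hl', hlen, hht⟩
              rw [List.prefix_cons_iff] at hl'
              obtain rfl | ⟨l'', rfl, hl''⟩ := hl'
              · simp at hht; omega
              · refine ⟨fun h => hl1 (by exact_mod_cast h.cons_true), l'', hl'', ?_, ?_⟩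
                · simp at hlen; omega
                · simpa using hht
            · refine le_trans (bernProb_mono h0 h1 ?_) e2
              rintro l - ⟨hl1, l', hl', hlen, hht⟩
              rw [List.prefix_cons_iff] at hl'
              obtain rfl | ⟨l'', rfl, hl''⟩ := hl'
              · simp at hht; omega
              · refine ⟨fun h => hl1 (DoubleRecord.cons_false (by exact_mod_cast h) (by positivity)),
                  l'', hl'', ?_, ?_⟩
                · simp at hlen; omega
                · simp at hht ⊢; omega
        _ = _ := by ring
    -- When exactly `K` steps are left only the empty prefix qualifies, and it does not reach a
    -- positive height.
    · rw [bernProb_eq_zero]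
      · exact bernProb_nonneg h0 h1
      · rintro l - ⟨-, l', -, hlen, hht⟩
        obtain rfl : l' = [] := List.length_eq_zero_iff.1 (by omega)
        simp at hht; omega

end

/-! ### The law of the initial string in terms of coin tosses -/

open Classical in
/-- The fraction of the indices `i` with entry `true` which satisfy `G i l`. -/
noncomputable def goodFrac (G : ℕ → List Bool → Prop) (l : List Bool) : ℝ :=
  (∑ i ∈ Finset.range l.length, if l[i]? = some true ∧ G i l then 1 else 0) / l.count true

lemma count_true_eq_sum (l : List Bool) :
    (l.count true : ℝ) = ∑ i ∈ Finset.range l.length, if l[i]? = some true then 1 else 0 := by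
  induction l with
  | nil => simp
  | cons b l ih =>
    rw [List.length_cons, Finset.sum_range_succ']
    simp only [List.getElem?_cons_succ, List.getElem?_cons_zero]
    rw [← ih]
    cases b <;> simp

lemma bernExp_eq_sum (q : ℝ) (n : ℕ) (F : List Bool → ℝ) :
    bernExp q n F = ∑ b : Fin n → Bool, (∏ i, if b i then q else 1 - q) * F (List.ofFn b) := by
  induction n generalizing F with
  | zero => simp [bernExp]
  | succ n ih =>
    rw [← (Fin.consEquiv fun _ => Bool).sum_comp, Fintype.sum_prod_type, Fintype.sum_bool]
    simp only [bernExp, ih, Finset.mul_sum, Fin.consEquiv_apply, Fin.prod_univ_succ, Fin.cons_zero,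
      Fin.cons_succ, List.ofFn_succ, if_true, Bool.false_eq_true, if_false, mul_assoc]

/-- The string of zeros and twos encoded by a list of coin tosses. -/
def ofBits {n : ℕ} (b : Fin n → Bool) : Fin n → Letter := fun i => if b i then 0 else 2

lemma ofBits_injective {n : ℕ} : Function.Injective (ofBits (n := n)) := by
  intro b b' h
  funext i
  have := congrFun h i
  unfold ofBits at this
  cases hb : b i <;> cases hb' : b' i <;> simp_all

/-- Given the coin tosses, the second class particle is uniform on the entries `true`, so the
fraction of good ones is a conditional probability. -/
lemma goodFrac_le_placeSecondClass {n : ℕ} (b : Fin n → Bool) (S : Set (Fin n → Letter))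
    (G : ℕ → List Bool → Prop)
    (hG : ∀ i : Fin n, b i = true → G i (List.ofFn b) → Function.update (ofBits b) i 1 ∈ S) :
    goodFrac G (List.ofFn b) ≤ (placeSecondClass (ofBits b)).toMeasure.real S := by
  classical
  have hfilter : (Finset.univ.filter fun i => ofBits b i = 0) = Finset.univ.filter fun i => b i = true := by
    ext i; simp [ofBits]
  unfold goodFrac
  rw [count_true_eq_sum, List.length_ofFn, Finset.sum_range, Finset.sum_range]
  have hget : ∀ i : Fin n, (List.ofFn b)[(i : ℕ)]? = some (b i) := fun i => by simp
  simp only [hget, Option.some.injEq]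
  by_cases h : (Finset.univ.filter fun i => ofBits b i = 0).Nonempty
  · have hS : MeasurableSet S := DiscreteMeasurableSpace.forall_measurableSet S
    unfold placeSecondClass
    rw [dif_pos h, Measure.real, PMF.toMeasure_map_apply _ _ _ (Measurable.of_discrete) hS,
      PMF.toMeasure_uniformOfFinset_apply _ _ (DiscreteMeasurableSpace.forall_measurableSet _)]
    rw [ENNReal.toReal_div, ENNReal.toReal_natCast, ENNReal.toReal_natCast, hfilter,
      Finset.sum_boole, Finset.sum_boole]
    gcongr
    intro i hi
    simp only [Finset.mem_filter, Finset.mem_univ, true_and, Set.mem_preimage] at hi ⊢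
    exact ⟨hi.1, hG i hi.1 hi.2⟩
  · have h0 : (∑ i : Fin n, if b i = true then (1 : ℝ) else 0) = 0 := by
      rw [hfilter, Finset.not_nonempty_iff_eq_empty] at h
      rw [Finset.sum_boole, h]; simp
    rw [h0, div_zero]
    positivity

lemma bernExp_goodFrac_le_initialLaw (p : I) {n : ℕ} (S : Set (Fin n → Letter))
    (G : ℕ → List Bool → Prop)
    (hG : ∀ (b : Fin n → Bool) (i : Fin n), b i = true → G i (List.ofFn b) →
      Function.update (ofBits b) i 1 ∈ S) :
    bernExp (1 - p) n (goodFrac G) ≤ (initialLaw p n).real S := by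
  classical
  have hS : MeasurableSet S := DiscreteMeasurableSpace.forall_measurableSet S
  have hw : ∀ b : Fin n → Bool, (Measure.pi fun _ : Fin n => bernoulliMeasure (2 : Letter) 0 p).real
      {ofBits b} = ∏ i, if b i then 1 - (p : ℝ) else 1 - (1 - p) := by
    intro b
    rw [Measure.real, Measure.pi_singleton, ENNReal.toReal_prod]
    refine Finset.prod_congr rfl fun i _ => ?_
    change (bernoulliMeasure (2 : Letter) 0 p).real {ofBits b i} = _
    rw [bernoulliMeasure_real_apply _ (DiscreteMeasurableSpace.forall_measurableSet _)]
    cases hb : b i <;> simp [ofBits, hb]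
  rw [bernExp_eq_sum, Measure.real, initialLaw,
    Measure.bind_apply hS (Measurable.of_discrete).aemeasurable, lintegral_fintype,
    ENNReal.toReal_sum (fun _ _ => ENNReal.mul_ne_top (measure_ne_top _ _) (measure_ne_top _ _))]
  simp only [ENNReal.toReal_mul]
  calc _ ≤ ∑ b : Fin n → Bool, (placeSecondClass (ofBits b)).toMeasure.real S *
        (Measure.pi fun _ : Fin n => bernoulliMeasure (2 : Letter) 0 p).real {ofBits b} := by
        refine Finset.sum_le_sum fun b _ => ?_
        rw [← hw, mul_comm]
        exact mul_le_mul_of_nonneg_right (goodFrac_le_placeSecondClass b S G (hG b))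
          measureReal_nonneg
    _ = ∑ ω ∈ Finset.univ.image (ofBits (n := n)), (placeSecondClass ω).toMeasure.real S *
        (Measure.pi fun _ : Fin n => bernoulliMeasure (2 : Letter) 0 p).real {ω} :=
        (Finset.sum_image (f := fun ω : Fin n → Letter => (placeSecondClass ω).toMeasure.real S *
          (Measure.pi fun _ : Fin n => bernoulliMeasure (2 : Letter) 0 p).real {ω})
          (ofBits_injective.injOn)).symm
    -- Strings `ω'` containing the letter 1 can only add nonnegative terms.
    _ ≤ _ := Finset.sum_le_sum_of_subset_of_nonneg (Finset.subset_univ _)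
        fun _ _ _ => mul_nonneg measureReal_nonneg measureReal_nonneg

/-! ### Convergence in distribution to a law on `{0, 1}` -/

/-- The two lower bounds add up to one in the limit, so both atoms converge and the remaining mass
vanishes. A bounded test function sees that mass with a factor of at most its norm. -/
lemma tendstoInDistribution_bernoulli {Ω : ℕ → Type*} [∀ n, MeasurableSpace (Ω n)]
    (μ : ∀ n, Measure (Ω n)) [∀ n, IsProbabilityMeasure (μ n)] (X : ∀ n, Ω n → ℝ)
    (hX : ∀ n, Measurable (X n)) (r : I)
    (h₀ : ∀ ε > 0, ∀ᶠ n in atTop, 1 - r - ε ≤ (μ n).real {ω | X n ω = 0})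
    (h₁ : ∀ ε > 0, ∀ᶠ n in atTop, r - ε ≤ (μ n).real {ω | X n ω = 1}) :
    TendstoInDistribution X atTop (id : ℝ → ℝ) μ (bernoulliMeasure (1 : ℝ) 0 r) where
  forall_aemeasurable n := (hX n).aemeasurable
  aemeasurable_limit := aemeasurable_id
  tendsto := by
    refine ProbabilityMeasure.tendsto_iff_forall_integral_tendsto.2 fun f => ?_
    change Tendsto (fun n => ∫ x, f x ∂((μ n).map (X n))) atTop
      (nhds (∫ x, f x ∂((bernoulliMeasure (1 : ℝ) 0 r).map id)))
    have hm0 : ∀ n, MeasurableSet {ω | X n ω = 0} := fun n => hX n (measurableSet_singleton 0)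
    have hm1 : ∀ n, MeasurableSet {ω | X n ω = 1} := fun n => hX n (measurableSet_singleton 1)
    have hsum : ∀ n, (μ n).real {ω | X n ω = 0} + (μ n).real {ω | X n ω = 1} ≤ 1 := by
      intro n
      rw [← measureReal_union _ (hm1 n)]
      · exact measureReal_le_one
      · rw [Set.disjoint_left]
        intro ω h h'
        have h1 : X n ω = 0 := h
        have h2 : X n ω = 1 := h'
        linarith
    have t0 : Tendsto (fun n => (μ n).real {ω | X n ω = 0}) atTop (nhds (1 - r)) := by
      refine Metric.tendsto_nhds.2 fun ε hε => ?_
      filter_upwards [h₀ (ε / 2) (by positivity), h₁ (ε / 2) (by positivity)] with n h h'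
      have := hsum n
      rw [Real.dist_eq, abs_lt]
      constructor <;> linarith
    have t1 : Tendsto (fun n => (μ n).real {ω | X n ω = 1}) atTop (nhds r) := by
      refine Metric.tendsto_nhds.2 fun ε hε => ?_
      filter_upwards [h₀ (ε / 2) (by positivity), h₁ (ε / 2) (by positivity)] with n h h'
      have := hsum n
      rw [Real.dist_eq, abs_lt]
      constructor <;> linarith
    have hlim : ∫ x, f x ∂((bernoulliMeasure (1 : ℝ) 0 r).map id) = r * f 1 + (1 - r) * f 0 := by
      rw [Measure.map_id, integral_bernoulliMeasure]
      simp
    have hint : ∀ n, ∫ x, f x ∂((μ n).map (X n)) = ∫ ω, f (X n ω) ∂(μ n) := fun n =>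
      integral_map (hX n).aemeasurable f.continuous.aestronglyMeasurable
    simp only [hlim, hint]
    rw [tendsto_iff_norm_sub_tendsto_zero]
    have hb : ∀ n, ‖(∫ ω, f (X n ω) ∂(μ n)) - (r * f 1 + (1 - r) * f 0)‖ ≤
        |(μ n).real {ω | X n ω = 1} - r| * |f 1| + |(μ n).real {ω | X n ω = 0} - (1 - r)| * |f 0| +
          ‖f‖ * (1 - (μ n).real {ω | X n ω = 0} - (μ n).real {ω | X n ω = 1}) := by
      intro n
      set A := {ω | X n ω = 0}
      set B := {ω | X n ω = 1}
      have hi1 : Integrable (fun ω => f (X n ω)) (μ n) :=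
        Integrable.of_bound (f.continuous.measurable.comp (hX n)).aestronglyMeasurable ‖f‖
          (Eventually.of_forall fun ω => f.norm_coe_le_norm _)
      have hiA : Integrable (A.indicator fun _ => f 0) (μ n) := (integrable_const _).indicator (hm0 n)
      have hiB : Integrable (B.indicator fun _ => f 1) (μ n) := (integrable_const _).indicator (hm1 n)
      have hiA1 : Integrable (A.indicator fun _ => (1 : ℝ)) (μ n) := (integrable_const _).indicator (hm0 n)
      have hiB1 : Integrable (B.indicator fun _ => (1 : ℝ)) (μ n) := (integrable_const _).indicator (hm1 n)
      have hs : Integrable (fun ω => f (X n ω) - A.indicator (fun _ => f 0) ω) (μ n) := hi1.sub hiA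
      have hi : Integrable (fun _ => (1 : ℝ)) (μ n) := integrable_const _
      have hs1 : Integrable (fun ω => 1 - A.indicator (fun _ => (1 : ℝ)) ω) (μ n) := hi.sub hiA1
      have hpt : ∀ ω, ‖f (X n ω) - A.indicator (fun _ => f 0) ω - B.indicator (fun _ => f 1) ω‖ ≤
          ‖f‖ * (1 - A.indicator (fun _ => (1 : ℝ)) ω - B.indicator (fun _ => (1 : ℝ)) ω) := by
        intro ω
        by_cases hA : X n ω = 0
        · have hB : ω ∉ B := fun h => by
            have h2 : X n ω = 1 := h
            linarith
          rw [Set.indicator_of_mem (show ω ∈ A from hA), Set.indicator_of_mem (show ω ∈ A from hA),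
            Set.indicator_of_notMem hB, Set.indicator_of_notMem hB, hA]
          simp
        · by_cases hB : X n ω = 1
          · rw [Set.indicator_of_notMem (show ω ∉ A from hA), Set.indicator_of_notMem (show ω ∉ A from hA),
              Set.indicator_of_mem (show ω ∈ B from hB), Set.indicator_of_mem (show ω ∈ B from hB), hB]
            simp
          · rw [Set.indicator_of_notMem (show ω ∉ A from hA), Set.indicator_of_notMem (show ω ∉ A from hA),
              Set.indicator_of_notMem (show ω ∉ B from hB), Set.indicator_of_notMem (show ω ∉ B from hB)]
            simpa using f.norm_coe_le_norm (X n ω)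
      have hI : ‖(∫ ω, f (X n ω) ∂(μ n)) - (μ n).real A * f 0 - (μ n).real B * f 1‖ ≤
          ‖f‖ * (1 - (μ n).real A - (μ n).real B) := by
        have e1 : (∫ ω, f (X n ω) ∂(μ n)) - (μ n).real A * f 0 - (μ n).real B * f 1 =
            ∫ ω, (f (X n ω) - A.indicator (fun _ => f 0) ω - B.indicator (fun _ => f 1) ω) ∂(μ n) := by
          rw [integral_sub hs hiB, integral_sub hi1 hiA,
            integral_indicator_const _ (hm0 n), integral_indicator_const _ (hm1 n)]
          simp [A, B]
        have e2 : ‖f‖ * (1 - (μ n).real A - (μ n).real B) =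
            ∫ ω, ‖f‖ * (1 - A.indicator (fun _ => (1 : ℝ)) ω - B.indicator (fun _ => (1 : ℝ)) ω) ∂(μ n) := by
          rw [integral_const_mul, integral_sub hs1 hiB1,
            integral_sub hi hiA1,
            integral_indicator_const _ (hm0 n), integral_indicator_const _ (hm1 n)]
          simp [A, B]
        rw [e1, e2]
        exact norm_integral_le_of_norm_le
          ((hs1.sub hiB1).const_mul _) (Eventually.of_forall hpt)
      have e3 : (∫ ω, f (X n ω) ∂(μ n)) - (r * f 1 + (1 - r) * f 0) =
          ((μ n).real B - r) * f 1 + ((μ n).real A - (1 - r)) * f 0 +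
            ((∫ ω, f (X n ω) ∂(μ n)) - (μ n).real A * f 0 - (μ n).real B * f 1) := by ring
      rw [e3, ← abs_mul, ← abs_mul]
      exact (norm_add_le _ _).trans (add_le_add (norm_add_le _ _) hI)
    refine squeeze_zero (fun n => norm_nonneg _) hb ?_
    have z1 : Tendsto (fun n => |(μ n).real {ω | X n ω = 1} - r|) atTop (nhds 0) := by
      simpa using (t1.sub_const (r : ℝ)).abs
    have z0 : Tendsto (fun n => |(μ n).real {ω | X n ω = 0} - (1 - r)|) atTop (nhds 0) := by
      simpa using (t0.sub_const (1 - r : ℝ)).abs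
    have z2 : Tendsto (fun n => 1 - (μ n).real {ω | X n ω = 0} - (μ n).real {ω | X n ω = 1}) atTop
        (nhds 0) := by
      simpa using (t0.const_sub 1).sub t1
    simpa using ((z1.mul_const |f 1|).add (z0.mul_const |f 0|)).add (z2.const_mul ‖f‖)

/-! ### Averages over the position of the second class particle -/

section

variable {q : ℝ} {n : ℕ} {A B G : ℕ → List Bool → Prop} {l : List Bool}

/-- The average over `i < n` of the probabilities of `B i`. -/
noncomputable def avgProb (q : ℝ) (B : ℕ → List Bool → Prop) (n : ℕ) : ℝ :=
  (∑ i ∈ Finset.range n, bernProb q n (B i)) / n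

lemma avgProb_nonneg (h0 : 0 ≤ q) (h1 : q ≤ 1) : 0 ≤ avgProb q B n :=
  div_nonneg (Finset.sum_nonneg fun _ _ => bernProb_nonneg h0 h1) (Nat.cast_nonneg _)

lemma goodFrac_nonneg : 0 ≤ goodFrac G l := by
  unfold goodFrac
  refine div_nonneg (Finset.sum_nonneg fun i _ => ?_) (Nat.cast_nonneg _)
  split_ifs <;> norm_num

lemma goodFrac_le_one : goodFrac G l ≤ 1 := by
  unfold goodFrac
  refine div_le_one_of_le₀ ?_ (Nat.cast_nonneg _)
  rw [count_true_eq_sum]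
  refine Finset.sum_le_sum fun i _ => ?_
  by_cases h : l[i]? = some true
  · simp only [h, true_and, if_true]; split_ifs <;> norm_num
  · simp [h]

lemma goodFrac_le_add (h : ∀ i < l.length, A i l → G i l ∨ B i l) :
    goodFrac A l ≤ goodFrac G l + goodFrac B l := by
  classical
  unfold goodFrac
  rw [← add_div, ← Finset.sum_add_distrib]
  refine div_le_div_of_nonneg_right (Finset.sum_le_sum fun i hi => ?_) (Nat.cast_nonneg _)
  have := h i (Finset.mem_range.1 hi)
  by_cases h0 : l[i]? = some true <;> by_cases h1 : A i l <;> by_cases h2 : G i l <;>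
    by_cases h3 : B i l <;> simp_all

lemma goodFrac_true (h : 0 < l.count true) : goodFrac (fun _ _ => True) l = 1 := by
  unfold goodFrac
  simp only [and_true]
  rw [← count_true_eq_sum, div_self]
  exact_mod_cast h.ne'

lemma bernExp_pow_count (w : ℝ) :
    bernExp q n (fun l => w ^ l.count true) = (q * w + (1 - q)) ^ n := by
  induction n with
  | zero => simp [bernExp]
  | succ n ih =>
    simp only [bernExp, List.count_cons_self, List.count_cons_of_ne (show false ≠ true by decide),
      pow_succ, mul_comm _ w]
    rw [bernExp_const_mul, ih]
    ring

/-- The number of entries `true` is small with exponentially small probability. -/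
lemma exists_bernProb_count_le (h0 : 0 < q) (h1 : q ≤ 1) : ∃ k : ℕ, 0 < k ∧ ∃ ρ : ℝ, 0 ≤ ρ ∧ ρ < 1 ∧
    ∀ n, bernProb q n (fun l => k * l.count true ≤ n) ≤ ρ ^ n := by
  -- Exponential Chebyshev bound for `s ^ (k * count)`, whose mean is `(q * s ^ k + 1 - q) ^ n`; the
  -- choice `s ^ k < 1 / 2` makes this base smaller than `s`.
  set s := 1 - q / 2 with hs
  have hs0 : 0 < s := by rw [hs]; linarith
  have hs1 : s < 1 := by rw [hs]; linarith
  obtain ⟨k, hk⟩ := exists_pow_lt_of_lt_one (show (0 : ℝ) < 1 / 2 by norm_num) hs1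
  have hk0 : 0 < k := by
    rcases Nat.eq_zero_or_pos k with rfl | h
    · norm_num at hk
    · exact h
  have hsk : 0 < s ^ k := by positivity
  refine ⟨k, hk0, (q * s ^ k + (1 - q)) / s, div_nonneg (by nlinarith) hs0.le, ?_, fun n => ?_⟩
  · rw [div_lt_one hs0, hs]
    nlinarith
  · rw [div_pow, le_div_iff₀ (by positivity), ← bernExp_pow_count, mul_comm, bernProb,
      ← bernExp_const_mul]
    refine bernExp_mono h0.le h1 fun l _ => ?_
    split_ifs with h
    · rw [mul_one, ← pow_mul]
      exact pow_le_pow_of_le_one hs0.le hs1.le h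
    · rw [mul_zero]; positivity

/-- If more than `n / k` entries are `true`, dividing by their number instead of `n` costs at most a
factor `k`. -/
lemma bernExp_goodFrac_le (h0 : 0 ≤ q) (h1 : q ≤ 1) {k : ℕ} (hn : 0 < n) :
    bernExp q n (goodFrac B) ≤
      bernProb q n (fun l => k * l.count true ≤ n) + k * avgProb q B n := by
  classical
  have hn' : (0 : ℝ) < n := by exact_mod_cast hn
  have e : k * avgProb q B n =
      bernExp q n fun l => (k / n : ℝ) * ∑ i ∈ Finset.range n, if B i l then 1 else 0 := by
    rw [bernExp_const_mul, bernExp_sum, avgProb]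
    simp only [bernProb]
    ring_nf
  rw [e, bernProb, ← bernExp_add]
  refine bernExp_mono h0 h1 fun l hl => ?_
  have hsum : (0 : ℝ) ≤ ∑ i ∈ Finset.range n, if B i l then 1 else 0 :=
    Finset.sum_nonneg fun i _ => by split_ifs <;> norm_num
  by_cases h : k * l.count true ≤ n
  · rw [if_pos h]
    have := goodFrac_le_one (G := B) (l := l)
    have : 0 ≤ (k / n : ℝ) * ∑ i ∈ Finset.range n, if B i l then 1 else 0 := by positivity
    linarith
  · rw [if_neg h, zero_add]
    unfold goodFrac
    rw [hl]
    have hle : (∑ i ∈ Finset.range n, if l[i]? = some true ∧ B i l then (1 : ℝ) else 0) ≤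
        ∑ i ∈ Finset.range n, if B i l then 1 else 0 := by
      refine Finset.sum_le_sum fun i _ => ?_
      by_cases hB : B i l <;> by_cases ht : l[i]? = some true <;> simp [hB, ht]
    have hc : (n : ℝ) < k * l.count true := by exact_mod_cast not_le.1 h
    have hc0 : (0 : ℝ) < l.count true := by
      by_contra hneg
      have h00 : (l.count true : ℝ) = 0 := le_antisymm (not_lt.1 hneg) (Nat.cast_nonneg _)
      rw [h00] at hc; linarith
    rw [div_le_iff₀ hc0]
    calc _ ≤ _ := hle
      _ = 1 * ∑ i ∈ Finset.range n, (if B i l then (1 : ℝ) else 0) := (one_mul _).symm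
      _ ≤ (k / n * l.count true) * ∑ i ∈ Finset.range n, (if B i l then (1 : ℝ) else 0) := by
        refine mul_le_mul_of_nonneg_right ?_ hsum
        rw [div_mul_eq_mul_div, le_div_iff₀ hn']
        linarith
      _ = _ := by ring

lemma tendsto_bernExp_goodFrac_zero (h0 : 0 < q) (h1 : q ≤ 1)
    (hB : Tendsto (avgProb q B) atTop (nhds 0)) :
    Tendsto (fun n => bernExp q n (goodFrac B)) atTop (nhds 0) := by
  obtain ⟨k, hk, ρ, hρ0, hρ1, hρ⟩ := exists_bernProb_count_le h0 h1
  have h : Tendsto (fun n => ρ ^ n + k * avgProb q B n) atTop (nhds 0) := by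
    simpa using (tendsto_pow_atTop_nhds_zero_of_lt_one hρ0 hρ1).add (hB.const_mul (k : ℝ))
  refine tendsto_of_tendsto_of_tendsto_of_le_of_le' tendsto_const_nhds h
    (Eventually.of_forall fun n => bernExp_nonneg h0.le h1 fun l _ => goodFrac_nonneg) ?_
  filter_upwards [eventually_gt_atTop 0] with n hn
  exact (bernExp_goodFrac_le h0.le h1 (k := k) hn).trans (add_le_add (hρ n) le_rfl)

lemma tendsto_bernExp_goodFrac_one (h0 : 0 < q) (h1 : q ≤ 1)
    (hG : Tendsto (avgProb q fun i l => ¬ G i l) atTop (nhds 0)) :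
    Tendsto (fun n => bernExp q n (goodFrac G)) atTop (nhds 1) := by
  classical
  obtain ⟨k, hk, ρ, hρ0, hρ1, hρ⟩ := exists_bernProb_count_le h0 h1
  have h : Tendsto (fun n => 1 - ρ ^ n - bernExp q n (goodFrac fun i l => ¬ G i l)) atTop (nhds 1) := by
    simpa using ((tendsto_pow_atTop_nhds_zero_of_lt_one hρ0 hρ1).const_sub 1).sub
      (tendsto_bernExp_goodFrac_zero h0 h1 hG)
  refine tendsto_of_tendsto_of_tendsto_of_le_of_le h tendsto_const_nhds (fun n => ?_) fun n => ?_
  · have e : 1 - bernProb q n (fun l => k * l.count true ≤ n) ≤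
        bernExp q n (goodFrac G) + bernExp q n (goodFrac fun i l => ¬ G i l) := by
      rw [← bernProb_not, ← bernExp_add, bernProb]
      refine bernExp_mono h0.le h1 fun l _ => ?_
      split_ifs with hc
      · exact add_nonneg goodFrac_nonneg goodFrac_nonneg
      · rw [← goodFrac_true (l := l)]
        · exact goodFrac_le_add fun i _ _ => em _
        · by_contra hz
          rw [Nat.eq_zero_of_not_pos hz] at hc
          simp at hc
    have := hρ n
    dsimp only
    linarith
  · dsimp only
    rw [← bernExp_const (q := q) (n := n) 1]
    exact bernExp_mono h0.le h1 fun l _ => goodFrac_le_one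

lemma avgProb_le_of_or (h0 : 0 ≤ q) (h1 : q ≤ 1)
    (h : ∀ i < n, ∀ l : List Bool, l.length = n → A i l → G i l ∨ B i l) :
    avgProb q A n ≤ avgProb q G n + avgProb q B n := by
  unfold avgProb
  rw [← add_div, ← Finset.sum_add_distrib]
  refine div_le_div_of_nonneg_right (Finset.sum_le_sum fun i hi => ?_) (Nat.cast_nonneg _)
  exact (bernProb_mono h0 h1 (h i (Finset.mem_range.1 hi))).trans (bernProb_or_le h0 h1)

lemma tendsto_avgProb_zero_of_le (h0 : 0 ≤ q) (h1 : q ≤ 1) {f : ℕ → ℝ}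
    (hf : Tendsto f atTop (nhds 0)) (h : ∀ n, ∀ i < n, bernProb q n (B i) ≤ f n) :
    Tendsto (avgProb q B) atTop (nhds 0) := by
  refine tendsto_of_tendsto_of_tendsto_of_le_of_le' tendsto_const_nhds hf
    (Eventually.of_forall fun n => avgProb_nonneg h0 h1) ?_
  filter_upwards [eventually_gt_atTop 0] with n hn
  have hn' : (0 : ℝ) < n := by exact_mod_cast hn
  unfold avgProb
  rw [div_le_iff₀ hn']
  calc _ ≤ ∑ i ∈ Finset.range n, f n := Finset.sum_le_sum fun i hi => h n i (Finset.mem_range.1 hi)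
    _ = f n * n := by simp [mul_comm]

/-- An average tends to `0` if the terms are, up to a sum which is bounded, eventually smaller
than any given positive number. -/
lemma tendsto_avgProb_zero_of_sum_le (h0 : 0 ≤ q) (h1 : q ≤ 1)
    (h : ∀ ε > 0, ∃ C : ℝ, ∀ n, ∑ i ∈ Finset.range n, bernProb q n (B i) ≤ C + ε * n) :
    Tendsto (avgProb q B) atTop (nhds 0) := by
  rw [Metric.tendsto_atTop]
  intro ε hε
  obtain ⟨C, hC⟩ := h (ε / 2) (by positivity)
  obtain ⟨N, hN⟩ := exists_nat_gt (C / (ε / 2))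
  refine ⟨N + 1, fun n hn => ?_⟩
  rw [Real.dist_eq, sub_zero, abs_of_nonneg (avgProb_nonneg h0 h1), avgProb]
  have hn' : (N : ℝ) + 1 ≤ n := by exact_mod_cast hn
  have hn0 : (0 : ℝ) < n := by have : (0 : ℝ) ≤ N := Nat.cast_nonneg _; linarith
  rw [div_lt_iff₀ hn0]
  rw [div_lt_iff₀ (by positivity)] at hN
  have := hC n
  nlinarith

end

/-! ### Simple estimates for the walk -/

section

variable {q : ℝ} {n : ℕ} {A : List Bool → Prop}

lemma bernProb_le_mul_pow (h0 : 0 ≤ q) (h1 : q ≤ 1) {z C : ℝ} (hz : 0 < z) (hC : 0 ≤ C)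
    (h : ∀ l : List Bool, l.length = n → A l → 1 ≤ C * z ^ ht l) :
    bernProb q n A ≤ C * (q * z + (1 - q) / z) ^ n := by
  rw [← bernExp_zpow_ht hz.ne', ← bernExp_const_mul]
  refine bernExp_mono h0 h1 fun l hl => ?_
  split_ifs with hA
  · exact h l hl hA
  · positivity

lemma bernProb_false_notMem : bernProb q n (fun l => false ∉ l) = q ^ n := by
  induction n with
  | zero => simp [bernProb, bernExp]
  | succ n ih =>
    rw [bernProb_succ, bernProb_eq_zero (A := fun l => false ∉ false :: l) (by simp)]
    simp [ih, pow_succ, mul_comm]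

lemma bernProb_true_notMem : bernProb q n (fun l => true ∉ l) = (1 - q) ^ n := by
  induction n with
  | zero => simp [bernProb, bernExp]
  | succ n ih =>
    rw [bernProb_succ, bernProb_eq_zero (A := fun l => true ∉ true :: l) (by simp)]
    simp [ih, pow_succ, mul_comm]

lemma sum_range_pow_le {c : ℝ} (hc0 : 0 ≤ c) (hc1 : c < 1) (n : ℕ) :
    ∑ i ∈ Finset.range n, c ^ i ≤ 1 / (1 - c) := by
  have h1 : 0 < 1 - c := by linarith
  rw [le_div_iff₀ h1]
  have := geom_sum_mul c n
  have h2 : 0 ≤ c ^ n := by positivity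
  nlinarith

/-- The probabilities `q ^ (n - 1 - i)` have a bounded sum over `i`. -/
lemma tendsto_avgProb_false_notMem_drop (h0 : 0 ≤ q) (h1 : q < 1) :
    Tendsto (avgProb q fun i l => false ∉ l.drop (i + 1)) atTop (nhds 0) := by
  refine tendsto_avgProb_zero_of_sum_le h0 h1.le fun ε hε => ⟨1 / (1 - q), fun n => ?_⟩
  calc _ = ∑ i ∈ Finset.range n, q ^ (n - 1 - i) := by
        refine Finset.sum_congr rfl fun i hi => ?_
        have hi := Finset.mem_range.1 hi
        obtain ⟨m, rfl⟩ : ∃ m, n = i + 1 + m := ⟨n - (i + 1), by omega⟩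
        rw [bernProb_drop (A := fun l => false ∉ l), bernProb_false_notMem]
        congr 1; omega
    _ = ∑ i ∈ Finset.range n, q ^ i := Finset.sum_range_reflect _ _
    _ ≤ 1 / (1 - q) := sum_range_pow_le h0 h1 n
    _ ≤ _ := by have : 0 ≤ ε * n := by positivity
                linarith

end

/-! ### The two favourable events -/

/-- Some site up to `i` has an entry `true` and a height which is not exceeded later, and there
is an entry `false` beyond the index `i`. -/
def LeftMax (i : ℕ) (l : List Bool) : Prop :=
  (∃ X ≤ i, zeroSite l X ∧
    ∀ y, X < y → y ≤ l.length → zeroSite l y → ht (l.take y) ≤ ht (l.take X)) ∧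
  false ∈ l.drop (i + 1)

/-- Beyond `i` there are two consecutive entries `true` at strict record heights, and then an
entry `false`. -/
def RightDouble (i : ℕ) (l : List Bool) : Prop :=
  ∃ y, i < y ∧ zeroSite l y ∧ zeroSite l (y + 1) ∧
    (∀ z < y, ht (l.take z) < ht (l.take y)) ∧ false ∈ l.drop (y + 1)

lemma exists_not_zeroSite {l : List Bool} {m : ℕ} (h : false ∈ l.drop m) :
    ∃ y, m < y ∧ ¬ zeroSite l y := by
  rw [List.mem_iff_getElem?] at h
  obtain ⟨j, hj⟩ := h
  rw [List.getElem?_drop] at hj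
  exact ⟨m + j + 1, by omega, fun hz => hz.2 (by simpa using hj)⟩

section

variable {n : ℕ} {b : Fin n → Bool} {i : Fin n}

lemma ofFn_update_ofBits (hb : b i = true) :
    List.ofFn b = List.ofFn fun j => decide (Function.update (ofBits b) i 1 j ≠ 2) := by
  congr 1
  funext j
  by_cases hj : j = i
  · subst hj; simp [hb]
  · rw [Function.update_of_ne hj, ofBits]
    cases b j <;> simp

lemma update_ofBits_ne_one (j : Fin n) (hj : j ≠ i) : Function.update (ofBits b) i 1 j ≠ 1 := by
  rw [Function.update_of_ne hj, ofBits]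
  split_ifs <;> decide

lemma excess_update_eq_one (hb : b i = true) (h : LeftMax i (List.ofFn b)) :
    excess (Function.update (ofBits b) i 1) = 1 := by
  obtain ⟨⟨X, hX, hX0, hmax⟩, htwo⟩ := h
  rw [List.length_ofFn] at hmax
  exact excess_eq_one (by simp) update_ofBits_ne_one (ofFn_update_ofBits hb) hX hX0 hmax
    (exists_not_zeroSite htwo)

lemma excess_update_eq_zero (hb : b i = true) (h : RightDouble i (List.ofFn b)) :
    excess (Function.update (ofBits b) i 1) = 0 := by
  obtain ⟨y, hy, hy0, hy1, hrec, htwo⟩ := h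
  exact excess_eq_zero (by simp) update_ofBits_ne_one (ofFn_update_ofBits hb) hy hy0 hy1 hrec
    (exists_not_zeroSite htwo)

end

lemma bernExp_leftMax_le (p : I) (n : ℕ) : bernExp (1 - p) n (goodFrac LeftMax) ≤
    (initialLaw p n).real {ω | ((excess ω : ℤ) : ℝ) = 1} := by
  refine bernExp_goodFrac_le_initialLaw p _ _ fun b i hb h => ?_
  have := excess_update_eq_one hb h
  simp [this]

lemma bernExp_rightDouble_le (p : I) (n : ℕ) : bernExp (1 - p) n (goodFrac RightDouble) ≤
    (initialLaw p n).real {ω | ((excess ω : ℤ) : ℝ) = 0} := by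
  refine bernExp_goodFrac_le_initialLaw p _ _ fun b i hb h => ?_
  have := excess_update_eq_zero hb h
  simp [this]

lemma zeroSite_append_cons (a b : List Bool) : zeroSite (a ++ true :: b) (a.length + 1) := by
  simp [zeroSite]

/-- A double record of the part beyond `i`, relative to the heights before, is a double record of
the whole. -/
lemma rightDouble_of_doubleRecord {i d : ℕ} {l : List Bool} (hi : i ≤ l.length)
    (hd : ∀ j ≤ i, ht (l.take j) ≤ ht (l.take i) + d) {b₁ b₂ : List Bool}
    (hl : l.drop i = b₁ ++ true :: true :: b₂) (h1 : (d : ℤ) ≤ ht b₁)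
    (h2 : ∀ b', b' <+: b₁ → ht b' ≤ ht b₁) (hf : false ∈ b₂) : RightDouble i l := by
  obtain ⟨a, rfl, rfl⟩ : ∃ a, l = a ++ (b₁ ++ true :: true :: b₂) ∧ a.length = i :=
    ⟨l.take i, by rw [← hl, List.take_append_drop], by simp [hi]⟩
  rw [List.take_left] at hd
  have e1 : a ++ (b₁ ++ true :: true :: b₂) = (a ++ b₁) ++ true :: (true :: b₂) := by simp
  have e2 : a ++ (b₁ ++ true :: true :: b₂) = (a ++ b₁ ++ [true]) ++ true :: b₂ := by simp
  have e3 : a ++ (b₁ ++ true :: true :: b₂) = (a ++ b₁ ++ [true, true]) ++ b₂ := by simp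
  have hlen : (a ++ b₁).length = a.length + b₁.length := by simp
  refine ⟨(a ++ b₁).length + 1, by rw [hlen]; omega, ?_, ?_, ?_, ?_⟩
  · rw [e1]; exact zeroSite_append_cons _ _
  · rw [e2]
    have := zeroSite_append_cons (a ++ b₁ ++ [true]) b₂
    simpa [add_assoc] using this
  · intro z hz
    have e4 : (a ++ (b₁ ++ true :: true :: b₂)).take ((a ++ b₁).length + 1) = a ++ b₁ ++ [true] := by
      rw [e2, List.take_left' (by simp [add_assoc])]
    rw [e4]
    simp only [ht_append, ht_cons_true, ht_nil]
    rcases Nat.lt_or_ge a.length z with h | h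
    · rw [List.take_append, List.take_of_length_le h.le, ht_append,
        List.take_append_of_le_length (by omega)]
      have := h2 (b₁.take (z - a.length)) (List.take_prefix _ _)
      omega
    · have := hd z h
      omega
  · have e5 : (a ++ (b₁ ++ true :: true :: b₂)).drop ((a ++ b₁).length + 1 + 1) = b₂ := by
      rw [e3, List.drop_left' (by simp [add_assoc])]
    rwa [e5]

/-- The height deficit with respect to the running maximum. -/
lemma exists_deficit (a : List Bool) : ∃ d : ℕ, (∀ j ≤ a.length, ht (a.take j) ≤ ht a + d) ∧
    ∃ j ≤ a.length, ht (a.take j) = ht a + d := by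
  obtain ⟨j, hj, hmax⟩ := (Finset.range (a.length + 1)).exists_max_image (fun j => ht (a.take j))
    ⟨0, by simp⟩
  have h0 := hmax a.length (by simp)
  rw [List.take_length] at h0
  refine ⟨(ht (a.take j) - ht a).toNat, fun m hm => ?_, j, by simpa [Nat.lt_succ_iff] using hj, ?_⟩
  · have := hmax m (by simpa [Nat.lt_succ_iff] using hm)
    omega
  · omega

lemma abs_ht_le_length (l : List Bool) : |ht l| ≤ l.length := by
  induction l with
  | nil => simp
  | cons b l ih =>
    rw [abs_le] at ih ⊢
    cases b <;> simp <;> omega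

lemma sum_ite_lt_le (n t : ℕ) : ∑ i ∈ Finset.range n, (if i < t then (1 : ℝ) else 0) ≤ t := by
  rw [Finset.sum_boole]
  have : (Finset.range n).filter (· < t) ⊆ Finset.range t := fun i hi => by
    simp at hi ⊢; exact hi.2
  exact_mod_cast (Finset.card_le_card this).trans (Finset.card_range t).le

/-! ### Downward drift -/

/-- An entry `true` among the first `t` has height at least `-t`, so no height beyond `i` exceeds
it. The highest zero site up to `i` then serves as `X`. -/
lemma leftMax_of_ht_le {i t : ℕ} {l : List Bool} (hti : t ≤ i) (hf : false ∈ l.drop (i + 1))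
    (ht0 : true ∈ l.take t) (hlow : ∀ y, i < y → y ≤ l.length → ht (l.take y) ≤ -t) :
    LeftMax i l := by
  refine ⟨?_, hf⟩
  obtain ⟨j, hj, hj'⟩ := List.mem_iff_getElem.1 ht0
  rw [List.length_take, lt_min_iff] at hj
  rw [List.getElem_take] at hj'
  have hz : zeroSite l (j + 1) := ⟨by omega, by simp [List.getElem?_eq_getElem hj.2, hj']⟩
  obtain ⟨X, hX, hmax⟩ := ((Finset.range (i + 1)).filter (zeroSite l)).exists_max_image
    (fun y => ht (l.take y)) ⟨j + 1, by simp [hz]; omega⟩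
  simp only [Finset.mem_filter, Finset.mem_range, Nat.lt_succ_iff] at hX hmax
  refine ⟨X, hX.1, hX.2, fun y _ hyl hy => ?_⟩
  rcases Nat.lt_or_ge i y with h | h
  · have h1 := hlow y h hyl
    have h2 := hmax (j + 1) ⟨by omega, hz⟩
    have h3 := abs_le.1 (abs_ht_le_length (l.take (j + 1)))
    have h4 : (l.take (j + 1)).length ≤ j + 1 := List.length_take_le _ _
    omega
  · exact hmax y ⟨h, hy⟩

lemma tendsto_avgProb_not_leftMax {q : ℝ} (h0 : 0 < q) (h1 : q < 1 / 2) :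
    Tendsto (avgProb q fun i l => ¬ LeftMax i l) atTop (nhds 0) := by
  have h1' : q ≤ 1 := by linarith
  -- Not the optimal tilt, but one for which `c` is the polynomial `1 / 2 + 2 * q * (1 - q)`, less
  -- than one for `q ≠ 1 / 2`.
  set z : ℝ := 1 / (2 * q) with hz
  set c : ℝ := q * z + (1 - q) / z with hc
  have hz0 : 0 < z := by positivity
  have hz1 : 1 ≤ z := by rw [hz, le_div_iff₀ (by positivity)]; linarith
  have hceq : c = 1 / 2 + 2 * q * (1 - q) := by rw [hc, hz]; field_simp
  have hc0 : 0 ≤ c := by rw [hceq]; nlinarith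
  have hc1 : c < 1 := by rw [hceq]; nlinarith
  have hB : Tendsto (avgProb q fun i l => ¬ LeftMax i l ∧ false ∈ l.drop (i + 1)) atTop (nhds 0) := by
    refine tendsto_avgProb_zero_of_sum_le h0.le h1' fun ε hε => ?_
    -- The first `t` entries are all `false` with probability below `ε`. Otherwise failure requires
    -- a height above `-t` beyond `i`, which is exponentially unlikely in `i`.
    obtain ⟨t, ht0⟩ := exists_pow_lt_of_lt_one hε (show 1 - q < 1 by linarith)
    refine ⟨t + z ^ t / (1 - c) * (1 / (1 - c)), fun n => ?_⟩
    have key : ∀ i ∈ Finset.range n,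
        bernProb q n (fun l => ¬ LeftMax i l ∧ false ∈ l.drop (i + 1)) ≤
          (if i < t then 1 else 0) + (ε + z ^ t / (1 - c) * c ^ i) := by
      intro i hi
      have hi := Finset.mem_range.1 hi
      have hD : 0 ≤ z ^ t / (1 - c) * c ^ i :=
        mul_nonneg (div_nonneg (by positivity) (by linarith)) (by positivity)
      split_ifs with hit
      · have := bernProb_le_one (q := q) (n := n)
          (A := fun l => ¬ LeftMax i l ∧ false ∈ l.drop (i + 1)) h0.le h1'
        linarith
      · rw [zero_add]
        have hti : t ≤ i := not_lt.1 hit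
        calc _ ≤ bernProb q n (fun l => true ∉ l.take t ∨
              ∃ m ∈ Finset.range (n - i), (-t : ℤ) ≤ ht (l.take (i + 1 + m))) := by
              refine bernProb_mono h0.le h1' ?_
              rintro l hl ⟨hL, hf⟩
              by_contra hcon
              push Not at hcon
              refine hL (leftMax_of_ht_le hti hf hcon.1 fun y hy hyl => ?_)
              have h := hcon.2 (y - (i + 1)) (Finset.mem_range.2 (by omega))
              rw [show i + 1 + (y - (i + 1)) = y by omega] at h
              exact h.le
          _ ≤ bernProb q n (fun l => true ∉ l.take t) + bernProb q n (fun l =>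
              ∃ m ∈ Finset.range (n - i), (-t : ℤ) ≤ ht (l.take (i + 1 + m))) :=
              bernProb_or_le h0.le h1'
          _ ≤ ε + ∑ m ∈ Finset.range (n - i), z ^ t * c ^ (i + m) := by
              refine add_le_add ?_ ((bernProb_exists_le h0.le h1' _ _).trans
                (Finset.sum_le_sum fun m hm => ?_))
              · obtain ⟨r, rfl⟩ := Nat.exists_eq_add_of_le (show t ≤ n by omega)
                rw [bernProb_take (A := fun l => true ∉ l), bernProb_true_notMem]
                exact ht0.le
              · have hm := Finset.mem_range.1 hm
                obtain ⟨r, rfl⟩ := Nat.exists_eq_add_of_le (show i + 1 + m ≤ n by omega)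
                rw [bernProb_take (A := fun l => (-t : ℤ) ≤ ht l)]
                refine (bernProb_le_mul_pow h0.le h1' hz0 (C := z ^ t) (by positivity)
                  fun l _ hl => ?_).trans (mul_le_mul_of_nonneg_left
                    (pow_le_pow_of_le_one hc0 hc1.le (by omega)) (by positivity))
                rw [← zpow_natCast, ← zpow_add₀ hz0.ne']
                exact one_le_zpow₀ hz1 (by omega)
          _ ≤ _ := by
              have e : ∑ m ∈ Finset.range (n - i), z ^ t * c ^ (i + m) =
                  z ^ t * c ^ i * ∑ m ∈ Finset.range (n - i), c ^ m := by
                rw [Finset.mul_sum]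
                exact Finset.sum_congr rfl fun m _ => by ring
              rw [e]
              have := mul_le_mul_of_nonneg_left (sum_range_pow_le hc0 hc1 (n - i))
                (show 0 ≤ z ^ t * c ^ i by positivity)
              have e2 : z ^ t * c ^ i * (1 / (1 - c)) = z ^ t / (1 - c) * c ^ i := by ring
              linarith
    refine (Finset.sum_le_sum key).trans ?_
    rw [Finset.sum_add_distrib, Finset.sum_add_distrib, ← Finset.mul_sum]
    have e1 := sum_ite_lt_le n t
    have e2 := mul_le_mul_of_nonneg_left (sum_range_pow_le hc0 hc1 n)
      (show 0 ≤ z ^ t / (1 - c) from div_nonneg (by positivity) (by linarith))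
    simp only [Finset.sum_const, Finset.card_range, nsmul_eq_mul]
    linarith
  have hsum := (tendsto_avgProb_false_notMem_drop h0.le (show q < 1 by linarith)).add hB
  rw [add_zero] at hsum
  refine tendsto_of_tendsto_of_tendsto_of_le_of_le tendsto_const_nhds hsum
    (fun n => avgProb_nonneg h0.le h1') fun n => ?_
  refine avgProb_le_of_or h0.le h1' fun i _ l _ h => ?_
  by_cases hf : false ∈ l.drop (i + 1)
  · exact Or.inr ⟨h, hf⟩
  · exact Or.inl hf

/-! ### Upward drift -/

lemma ht_take_add (l : List Bool) (m k : ℕ) :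
    ht (l.take (m + k)) = ht (l.take m) + ht ((l.drop m).take k) := by
  rw [List.take_add, ht_append]

/-- The steps beyond `i` are split into blocks of lengths `M`, `K`, `K`: by the end of the first the
walk is back at its old maximum, by the end of the second it has made a double record, and the third
contains a `false`. The three terms bound the failures. -/
lemma bernProb_not_rightDouble_le {q c : ℝ} (h0 : 1 / 2 ≤ q) (h1 : q ≤ 1) (hc0 : 0 ≤ c)
    (hc1 : c < 1) (hc : ∀ n, bernProb q n (fun l => ht l < 0) ≤ c ^ n) (i M K : ℕ) :
    bernProb q (i + (M + K + K)) (fun l => ¬ RightDouble i l) ≤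
      c ^ M / (1 - c) + q ^ K + bernProb q K (fun l => ¬ DoubleRecord 0 l) := by
  have h0' : 0 ≤ q := by linarith
  set E₁ : List Bool → Prop := fun l => ∃ j ∈ Finset.range (i + 1),
    ht (l.take (i + M)) < ht (l.take j) with hE₁
  set E₂ : List Bool → Prop := fun l => false ∉ l.drop (i + (M + K)) with hE₂
  have p1 : bernProb q (i + (M + K + K)) E₁ ≤ c ^ M / (1 - c) := by
    refine (bernProb_exists_le h0' h1 _ _).trans ?_
    calc _ ≤ ∑ j ∈ Finset.range (i + 1), c ^ M * c ^ (i + 1 - 1 - j) := by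
          refine Finset.sum_le_sum fun j hj => ?_
          have hj : j ≤ i := Nat.lt_succ_iff.1 (Finset.mem_range.1 hj)
          obtain ⟨r, rfl⟩ := Nat.exists_eq_add_of_le hj
          have e : j + r + (M + K + K) = j + ((r + M) + (K + K)) := by ring
          rw [e, ← pow_add, show M + (j + r + 1 - 1 - j) = r + M by omega]
          calc _ = bernProb q (j + ((r + M) + (K + K)))
                  (fun l => ht ((l.drop j).take (r + M)) < 0) := by
                refine bernProb_congr fun l _ => ?_
                rw [add_assoc, ht_take_add]
                constructor <;> intro h <;> linarith
            _ = bernProb q (r + M) (fun l => ht l < 0) := by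
                rw [bernProb_drop (A := fun l => ht (l.take (r + M)) < 0),
                  bernProb_take (A := fun l => ht l < 0)]
            _ ≤ _ := hc _
      _ = c ^ M * ∑ j ∈ Finset.range (i + 1), c ^ j := by
          rw [← Finset.mul_sum, Finset.sum_range_reflect (fun j => c ^ j)]
      _ ≤ c ^ M * (1 / (1 - c)) :=
          mul_le_mul_of_nonneg_left (sum_range_pow_le hc0 hc1 _) (by positivity)
      _ = _ := by ring
  have p2 : bernProb q (i + (M + K + K)) E₂ = q ^ K := by
    rw [← add_assoc, bernProb_drop (A := fun l => false ∉ l), bernProb_false_notMem]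
  have p3 : bernProb q (i + (M + K + K)) (fun l => ¬ RightDouble i l ∧ ¬ E₁ l ∧ ¬ E₂ l) ≤
      bernProb q K (fun l => ¬ DoubleRecord 0 l) := by
    -- Of the first `i` entries only the deficit `d` below their maximum matters.
    refine bernProb_append_le h0' h1 fun a ha => ?_
    obtain ⟨d, hd, j, hj, hjd⟩ := exists_deficit a
    refine le_trans ?_ (bernProb_reach_not_doubleRecord_le (n := M + K) (K := K) h0' h1
      (Nat.le_add_left _ _) d)
    rw [← bernProb_take (m := M + K) (n := K)]
    refine bernProb_mono h0' h1 ?_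
    rintro b hb ⟨hR, hn1, hn2⟩
    have htake : ∀ k ≤ i, (a ++ b).take k = a.take k := fun k hk =>
      List.take_append_of_le_length (by omega)
    have hdrop : (a ++ b).drop i = b := by rw [← ha, List.drop_left]
    refine ⟨?_, b.take M, ?_, ?_, ?_⟩
    · rintro ⟨b₁, b₂, hb12, hd1, hmax⟩
      refine hR (rightDouble_of_doubleRecord (d := d) (b₁ := b₁) (b₂ := b₂ ++ b.drop (M + K))
        (by simp; omega) ?_ ?_ hd1 hmax ?_)
      · intro k hk
        rw [htake k hk, htake i le_rfl, ← ha, List.take_length]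
        exact hd k (by omega)
      · rw [hdrop]
        conv_lhs => rw [← List.take_append_drop (M + K) b, hb12]
        simp
      · rw [hE₂] at hn2
        dsimp only at hn2
        rw [not_not, ← List.drop_drop, hdrop] at hn2
        exact List.mem_append_right _ hn2
    · have e : b.take M = (b.take (M + K)).take M := by
        rw [List.take_take, min_eq_left (Nat.le_add_right M K)]
      rw [e]
      exact List.take_prefix _ _
    · have := List.length_take_le M b
      omega
    · by_contra hlt
      refine hn1 ⟨j, Finset.mem_range.2 (by omega), ?_⟩
      rw [htake j (by omega), ht_take_add, htake i le_rfl, hdrop, hjd, ← ha, List.take_length]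
      omega
  calc _ ≤ bernProb q (i + (M + K + K)) (fun l => (E₁ l ∨ E₂ l) ∨
        (¬ RightDouble i l ∧ ¬ E₁ l ∧ ¬ E₂ l)) := by
        refine bernProb_mono h0' h1 fun l _ h => ?_
        by_cases h₁ : E₁ l
        · exact Or.inl (Or.inl h₁)
        · by_cases h₂ : E₂ l
          · exact Or.inl (Or.inr h₂)
          · exact Or.inr ⟨h, h₁, h₂⟩
    _ ≤ _ := (bernProb_or_le h0' h1).trans (add_le_add ((bernProb_or_le h0' h1).trans
        (add_le_add p1 p2.le)) p3)

lemma tendsto_avgProb_not_rightDouble {q : ℝ} (h0 : 1 / 2 < q) (h1 : q < 1) :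
    Tendsto (avgProb q fun i l => ¬ RightDouble i l) atTop (nhds 0) := by
  have h0' : 0 ≤ q := by linarith
  have h1q : 0 < 1 - q := by linarith
  -- The mirror image of the tilt used for downward drift, with the same `c`.
  set z : ℝ := 2 * (1 - q) with hz
  set c : ℝ := q * z + (1 - q) / z with hc
  have hz0 : 0 < z := by positivity
  have hz1 : z ≤ 1 := by rw [hz]; linarith
  have hceq : c = 1 / 2 + 2 * q * (1 - q) := by
    rw [hc, hz]
    have : (1 - q) / (2 * (1 - q)) = 1 / 2 := by field_simp
    rw [this]; ring
  have hc0 : 0 < c := by rw [hceq]; nlinarith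
  have hc1 : c < 1 := by rw [hceq]; nlinarith
  have hneg : ∀ n, bernProb q n (fun l => ht l < 0) ≤ c ^ n := by
    intro n
    rw [← one_mul (c ^ n)]
    refine bernProb_le_mul_pow h0' h1.le hz0 zero_le_one fun l _ hl => ?_
    rw [one_mul]
    exact one_le_zpow_of_nonpos₀ hz0 hz1 hl.le
  refine tendsto_avgProb_zero_of_sum_le h0' h1.le fun ε hε => ?_
  have hlim := (tendsto_pow_atTop_nhds_zero_of_lt_one h0' h1).add
    (tendsto_bernProb_not_doubleRecord h0.le h1.le)
  rw [add_zero] at hlim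
  obtain ⟨K, hK⟩ := (hlim.eventually (gt_mem_nhds hε)).exists
  refine ⟨(2 * K : ℕ) + 1 / ((1 - c) * c ^ (2 * K)) * (1 / (1 - c)), fun n => ?_⟩
  -- The constant absorbs the last two blocks: `n - 1 - i = M + 2 * K` for a first block of length
  -- `M + 1`.
  set D : ℝ := 1 / ((1 - c) * c ^ (2 * K)) with hD
  have h1c : 0 < 1 - c := by linarith
  have hD0 : 0 ≤ D := by positivity
  have key : ∀ i ∈ Finset.range n, bernProb q n (fun l => ¬ RightDouble i l) ≤
      (if n - 1 - i < 2 * K then 1 else 0) + (ε + D * c ^ (n - 1 - i)) := by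
    intro i hi
    have hi := Finset.mem_range.1 hi
    have hDc : 0 ≤ D * c ^ (n - 1 - i) := by positivity
    split_ifs with hit
    · have := bernProb_le_one (q := q) (n := n) (A := fun l => ¬ RightDouble i l) h0' h1.le
      linarith
    · obtain ⟨M, rfl⟩ : ∃ M, n = i + (M + 1 + K + K) := ⟨n - i - 2 * K - 1, by omega⟩
      have := bernProb_not_rightDouble_le h0.le h1.le hc0.le hc1 hneg i (M + 1) K
      have e : D * c ^ (i + (M + 1 + K + K) - 1 - i) = c ^ M / (1 - c) := by
        rw [show i + (M + 1 + K + K) - 1 - i = M + 2 * K by omega, pow_add, hD]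
        field_simp
      have e2 : c ^ (M + 1) / (1 - c) ≤ c ^ M / (1 - c) :=
        div_le_div_of_nonneg_right (pow_le_pow_of_le_one hc0.le hc1.le (Nat.le_succ M)) h1c.le
      rw [e]
      linarith
  refine (Finset.sum_le_sum key).trans ?_
  rw [Finset.sum_range_reflect (fun r => (if r < 2 * K then (1 : ℝ) else 0) + (ε + D * c ^ r)),
    Finset.sum_add_distrib, Finset.sum_add_distrib, ← Finset.mul_sum]
  have e1 := sum_ite_lt_le n (2 * K)
  have e2 := mul_le_mul_of_nonneg_left (sum_range_pow_le hc0.le hc1 n) hD0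
  simp only [Finset.sum_const, Finset.card_range, nsmul_eq_mul]
  linarith

/-! ### The symmetric walk -/

/-- All heights up to the end are at most the final height. -/
def EndsAtMax (l : List Bool) : Prop := ∀ y ≤ l.length, ht (l.take y) ≤ ht l

/-- The heights never become positive. -/
def NeverPos (l : List Bool) : Prop := ∀ y ≤ l.length, ht (l.take y) ≤ 0

/-- The heights beyond `i` are smaller than some height up to `i`. -/
def MaxBefore (i : ℕ) (l : List Bool) : Prop :=
  ∃ j ≤ i, ∀ y, i < y → y ≤ l.length → ht (l.take y) < ht (l.take j)

/-- Some height beyond `i` is larger than all heights up to `i`. -/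
def RecordAfter (i : ℕ) (l : List Bool) : Prop :=
  ∃ y, i < y ∧ y ≤ l.length ∧ ∀ j ≤ i, ht (l.take j) < ht (l.take y)

/-- Some height beyond `i` is at least as large as all heights up to `i`, but there is no double
record beyond `i`. -/
def ReachNoDouble (i : ℕ) (l : List Bool) : Prop :=
  (∃ y, i < y ∧ y ≤ l.length ∧ ∀ j ≤ i, ht (l.take j) ≤ ht (l.take y)) ∧
  ¬ ∃ d : ℕ, (∀ j ≤ i, ht (l.take j) ≤ ht (l.take i) + d) ∧ DoubleRecord d (l.drop i)

/-- The list read backwards, with `true` and `false` exchanged. -/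
def flipReverse (l : List Bool) : List Bool := (l.map (!·)).reverse

lemma length_flipReverse (l : List Bool) : (flipReverse l).length = l.length := by
  simp [flipReverse]

lemma ht_map_not (l : List Bool) : ht (l.map (!·)) = -ht l := by
  induction l with
  | nil => rfl
  | cons b l ih => cases b <;> simp [ih] <;> ring

lemma ht_reverse (l : List Bool) : ht l.reverse = ht l := by
  unfold ht
  rw [List.map_reverse, List.sum_reverse]

/-- The transformed list traces the same path backwards in time, recentred at its endpoint. -/
lemma ht_take_flipReverse {l : List Bool} {y : ℕ} :
    ht ((flipReverse l).take y) = ht (l.take (l.length - y)) - ht l := by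
  rw [flipReverse, List.take_reverse, ht_reverse, ← List.map_drop, ht_map_not, List.length_map]
  have := congrArg ht (List.take_append_drop (l.length - y) l)
  rw [ht_append] at this
  linarith

lemma ht_flipReverse (l : List Bool) : ht (flipReverse l) = - ht l := by
  rw [flipReverse, ht_reverse, ht_map_not]

lemma bernProb_flipReverse {n : ℕ} (A : List Bool → Prop) :
    bernProb (1 / 2) n (fun l => A (flipReverse l)) = bernProb (1 / 2) n A := by
  classical
  unfold bernProb flipReverse
  rw [bernExp_map_not (F := fun l => if A l.reverse then 1 else 0),
    bernExp_reverse (F := fun l => if A l then 1 else 0)]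

lemma bernProb_endsAtMax (n : ℕ) :
    bernProb (1 / 2) n EndsAtMax = bernProb (1 / 2) n NeverPos := by
  rw [← bernProb_flipReverse]
  refine bernProb_congr fun l _ => ?_
  unfold EndsAtMax NeverPos
  simp only [length_flipReverse, ht_take_flipReverse, ht_flipReverse]
  constructor
  · intro h y hy
    have := h (l.length - y) (Nat.sub_le _ _)
    rw [Nat.sub_sub_self hy] at this
    linarith
  · intro h y hy
    have := h (l.length - y) (Nat.sub_le _ _)
    linarith

/-- Backwards in time, a height beyond `i` above all earlier ones becomes an early height above all
later ones. The `n - i` lengths beyond `i` turn into those up to `n - 1 - i`. -/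
lemma bernProb_recordAfter {n i : ℕ} (hi : i < n) :
    bernProb (1 / 2) n (RecordAfter i) = bernProb (1 / 2) n (MaxBefore (n - 1 - i)) := by
  rw [← bernProb_flipReverse]
  refine bernProb_congr fun l hl => ?_
  unfold RecordAfter MaxBefore
  simp only [length_flipReverse, ht_take_flipReverse, hl]
  constructor
  · rintro ⟨y, hy, hyn, h⟩
    refine ⟨n - y, by omega, fun m hm hmn => ?_⟩
    have := h (n - m) (by omega)
    rw [Nat.sub_sub_self hmn] at this
    linarith
  · rintro ⟨j, hj, h⟩
    refine ⟨n - j, by omega, Nat.sub_le _ _, fun m hm => ?_⟩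
    have := h (n - m) (by omega) (Nat.sub_le _ _)
    rw [Nat.sub_sub_self (by omega)]
    linarith

lemma not_doubleRecord_of_neverPos {l : List Bool} (h : NeverPos l) : ¬ DoubleRecord 0 l := by
  rintro ⟨a, b, rfl, h0, -⟩
  have := h (a.length + 1) (by simp)
  rw [show a ++ true :: true :: b = (a ++ [true]) ++ true :: b by simp,
    List.take_left' (by simp)] at this
  simp at this
  omega

/-- A double record at level 0 forces a positive height, so the decay is inherited from that of
missing double records. -/
lemma tendsto_bernProb_neverPos : Tendsto (fun n => bernProb (1 / 2) n NeverPos) atTop (nhds 0) :=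
  squeeze_zero (fun _ => bernProb_nonneg (by norm_num) (by norm_num))
    (fun _ => bernProb_mono (by norm_num) (by norm_num) fun _ _ => not_doubleRecord_of_neverPos)
    (tendsto_bernProb_not_doubleRecord le_rfl (by norm_num))

/-- On this event the overall maximum is attained beyond `i`. Either it is attained fewer than `K`
steps before the end, and a prefix of length `n - k` ends at its maximum, or at least `K` steps
remain in which a double record is missing. -/
lemma bernProb_reachNoDouble_le {n i : ℕ} (hi : i < n) (K : ℕ) :
    bernProb (1 / 2) n (ReachNoDouble i) ≤
      ∑ k ∈ Finset.range K, bernProb (1 / 2) (n - k) EndsAtMax +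
        bernProb (1 / 2) K (fun l => ¬ DoubleRecord 0 l) := by
  have h0 : (0 : ℝ) ≤ 1 / 2 := by norm_num
  have h1 : (1 / 2 : ℝ) ≤ 1 := by norm_num
  set E : List Bool → Prop := fun l => ∃ k ∈ Finset.range K, EndsAtMax (l.take (n - k)) with hE
  have p1 : bernProb (1 / 2) n E ≤ ∑ k ∈ Finset.range K, bernProb (1 / 2) (n - k) EndsAtMax := by
    refine (bernProb_exists_le h0 h1 _ _).trans (Finset.sum_le_sum fun k _ => ?_)
    obtain ⟨m, r, hm, rfl⟩ : ∃ m r, n - k = m ∧ n = m + r := ⟨n - k, n - (n - k), rfl, by omega⟩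
    rw [hm, bernProb_take]
  -- outside of `E`, the maximum is reached early
  have key : ∀ l : List Bool, l.length = n → ReachNoDouble i l → ¬ E l →
      ∃ y, i < y ∧ y + K ≤ n ∧ ∀ j ≤ i, ht (l.take j) ≤ ht (l.take y) := by
    rintro l hl ⟨⟨y, hy, hyn, hmax⟩, -⟩ hnE
    obtain ⟨x, hx, hxmax⟩ := (Finset.Ioc i n).exists_max_image (fun y => ht (l.take y))
      ⟨y, by simp; omega⟩
    rw [Finset.mem_Ioc] at hx
    have hyx := hxmax y (by simp; omega)
    have hall : ∀ j ≤ n, ht (l.take j) ≤ ht (l.take x) := by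
      intro j hj
      rcases Nat.lt_or_ge i j with h | h
      · exact hxmax j (by simp; omega)
      · exact (hmax j h).trans hyx
    refine ⟨x, hx.1, ?_, fun j hj => hall j (by omega)⟩
    by_contra hlt
    refine hnE ⟨n - x, by simp; omega, ?_⟩
    rw [show n - (n - x) = x by omega]
    intro j hj
    rw [List.take_take]
    exact hall _ (by omega)
  have p2 : bernProb (1 / 2) n (fun l => ReachNoDouble i l ∧ ¬ E l) ≤
      bernProb (1 / 2) K (fun l => ¬ DoubleRecord 0 l) := by
    rcases Nat.lt_or_ge n (i + K) with hlt | hge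
    · rw [bernProb_eq_zero]
      · exact bernProb_nonneg h0 h1
      · rintro l hl ⟨hR, hnE⟩
        obtain ⟨y, hy, hyn, -⟩ := key l hl hR hnE
        omega
    · obtain ⟨N, rfl⟩ := Nat.exists_eq_add_of_le hi.le
      refine bernProb_append_le h0 h1 fun a ha => ?_
      obtain ⟨d, hd, j, hj, hjd⟩ := exists_deficit a
      refine le_trans (bernProb_mono h0 h1 ?_)
        (bernProb_reach_not_doubleRecord_le (n := N) (K := K) h0 h1 (by omega) d)
      rintro b hb ⟨hR, hnE⟩
      have htake : ∀ k ≤ i, (a ++ b).take k = a.take k := fun k hk =>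
        List.take_append_of_le_length (by omega)
      have hdrop : (a ++ b).drop i = b := by rw [← ha, List.drop_left]
      refine ⟨fun hD => hR.2 ⟨d, fun k hk => ?_, by rwa [hdrop]⟩, ?_⟩
      · rw [htake k hk, htake i le_rfl, ← ha, List.take_length]
        exact hd k (by omega)
      · obtain ⟨y, hy, hyn, hymax⟩ := key (a ++ b) (by simp [ha, hb]) hR hnE
        obtain ⟨m, rfl⟩ := Nat.exists_eq_add_of_le hy.le
        refine ⟨b.take m, List.take_prefix _ _, ?_, ?_⟩
        · have := List.length_take_le m b
          omega
        · have := hymax j (by omega)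
          rw [htake j (by omega), ht_take_add, htake i le_rfl, hdrop, hjd, ← ha,
            List.take_length] at this
          omega
  calc _ ≤ bernProb (1 / 2) n (fun l => E l ∨ (ReachNoDouble i l ∧ ¬ E l)) := by
        refine bernProb_mono h0 h1 fun l _ h => ?_
        by_cases hEl : E l
        · exact Or.inl hEl
        · exact Or.inr ⟨h, hEl⟩
    _ ≤ _ := (bernProb_or_le h0 h1).trans (add_le_add p1 p2)

lemma tendsto_avgProb_reachNoDouble :
    Tendsto (avgProb (1 / 2) ReachNoDouble) atTop (nhds 0) := by
  have h0 : (0 : ℝ) ≤ 1 / 2 := by norm_num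
  have h1 : (1 / 2 : ℝ) ≤ 1 := by norm_num
  rw [Metric.tendsto_atTop]
  intro ε hε
  obtain ⟨K, hK⟩ := ((tendsto_bernProb_not_doubleRecord (q := 1 / 2) le_rfl h1).eventually
    (gt_mem_nhds (half_pos hε))).exists
  have hlim : Tendsto (fun n => ∑ k ∈ Finset.range K, bernProb (1 / 2) (n - k) EndsAtMax) atTop
      (nhds 0) := by
    simp only [bernProb_endsAtMax]
    simpa using tendsto_finsetSum (Finset.range K) fun k _ =>
      tendsto_bernProb_neverPos.comp (tendsto_sub_atTop_nat k)
  obtain ⟨N, hN⟩ := eventually_atTop.1 (hlim.eventually (gt_mem_nhds (half_pos hε)))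
  refine ⟨N + 1, fun n hn => ?_⟩
  have hn0 : (0 : ℝ) < n := by exact_mod_cast (show 0 < n by omega)
  rw [Real.dist_eq, sub_zero, abs_of_nonneg (avgProb_nonneg h0 h1), avgProb, div_lt_iff₀ hn0]
  have hNn := hN n (by omega)
  calc _ ≤ ∑ i ∈ Finset.range n, (∑ k ∈ Finset.range K, bernProb (1 / 2) (n - k) EndsAtMax +
        bernProb (1 / 2) K (fun l => ¬ DoubleRecord 0 l)) :=
        Finset.sum_le_sum fun i hi => bernProb_reachNoDouble_le (Finset.mem_range.1 hi) K
    _ < ε * n := by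
        rw [Finset.sum_const, Finset.card_range, nsmul_eq_mul, mul_comm]
        exact mul_lt_mul_of_pos_right (by linarith) hn0

/-- The maximum is first attained by a step up, hence at an entry `true`, unless it is attained at
the origin, and then the path never becomes positive. -/
lemma leftMax_of_maxBefore {i : ℕ} {l : List Bool} (hi : i < l.length) (h : MaxBefore i l)
    (hf : false ∈ l.drop (i + 1)) (hp : ¬ NeverPos l) : LeftMax i l := by
  refine ⟨?_, hf⟩
  obtain ⟨j, hj, hjmax⟩ := h
  obtain ⟨X, hX, hmax⟩ := (Finset.range (i + 1)).exists_max_image (fun y => ht (l.take y))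
    ⟨0, by simp⟩
  have hXall : ∀ y ≤ l.length, ht (l.take y) ≤ ht (l.take X) := by
    intro y hy
    rcases Nat.lt_or_ge i y with h | h
    · exact (hjmax y h hy).le.trans (hmax j (by simp; omega))
    · exact hmax y (by simp; omega)
  -- the first site at which the maximum is reached
  have hex : ∃ Y, ht (l.take X) ≤ ht (l.take Y) := ⟨X, le_rfl⟩
  classical
  set Y := Nat.find hex with hY
  have hYspec : ht (l.take X) ≤ ht (l.take Y) := Nat.find_spec hex
  have hYX : Y ≤ X := Nat.find_min' hex le_rfl
  have hXi : X ≤ i := by simpa [Nat.lt_succ_iff] using hX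
  have hY0 : Y ≠ 0 := by
    intro h0
    rw [h0] at hYspec
    refine hp fun y hy => (hXall y hy).trans ?_
    simpa using hYspec
  obtain ⟨m, hm⟩ := Nat.exists_eq_succ_of_ne_zero hY0
  have hml : m < l.length := by omega
  refine ⟨Y, hYX.trans hXi, ?_, fun y _ hy _ => (hXall y hy).trans hYspec⟩
  have hmin := Nat.find_min hex (m := m) (by omega)
  rw [hm, Nat.succ_eq_add_one, List.take_succ_eq_append_getElem hml, ht_append] at hYspec
  refine ⟨by omega, ?_⟩
  rw [hm, Nat.succ_eq_add_one, Nat.add_sub_cancel, List.getElem?_eq_getElem hml]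
  cases hb : l[m]
  · rw [hb] at hYspec; simp at hYspec; omega
  · simp

lemma ht_nonneg_of_false_notMem {l : List Bool} (h : false ∉ l) : 0 ≤ ht l := by
  induction l with
  | nil => simp
  | cons b l ih =>
    rw [List.mem_cons, not_or] at h
    have := ih h.2
    cases b
    · exact absurd rfl h.1
    · simp; omega

/-- The double record exists, and only a later `false` is in question. Without one the path would
rise from a record to its end and so end at its maximum. -/
lemma rightDouble_of_recordAfter {i : ℕ} {l : List Bool} (hi : i < l.length)
    (h : RecordAfter i l) (he : ¬ EndsAtMax l) (hr : ¬ ReachNoDouble i l) : RightDouble i l := by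
  obtain ⟨y, hy, hyl, hmax⟩ := h
  have : ∃ d : ℕ, (∀ j ≤ i, ht (l.take j) ≤ ht (l.take i) + d) ∧ DoubleRecord d (l.drop i) := by
    by_contra hcon
    exact hr ⟨⟨y, hy, hyl, fun j hj => (hmax j hj).le⟩, hcon⟩
  obtain ⟨d, hd, b₁, b₂, hb, h1, h2⟩ := this
  refine rightDouble_of_doubleRecord hi.le hd hb h1 h2 ?_
  by_contra hf
  refine he fun m hm => ?_
  have hll : l = (l.take i ++ b₁) ++ true :: true :: b₂ := by
    rw [List.append_assoc, ← hb, List.take_append_drop]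
  have hli : (l.take i).length = i := by simp [hi.le]
  have hht : ht l = ht (l.take i) + ht b₁ + ht (true :: true :: b₂) := by
    conv_lhs => rw [hll, ht_append, ht_append]
  have hnf : false ∉ true :: true :: b₂ := by simp [hf]
  have h3 := ht_nonneg_of_false_notMem hnf
  rcases Nat.lt_or_ge i m with him | him
  · obtain ⟨k, rfl⟩ := Nat.exists_eq_add_of_le him.le
    rw [ht_take_add, hb, hht]
    rcases Nat.lt_or_ge k b₁.length with hk | hk
    · rw [List.take_append_of_le_length hk.le]
      have := h2 _ (List.take_prefix k b₁)
      omega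
    · rw [List.take_append, List.take_of_length_le hk, ht_append]
      have h4 := congrArg ht (List.take_append_drop (k - b₁.length) (true :: true :: b₂))
      rw [ht_append] at h4
      have h5 := ht_nonneg_of_false_notMem (l := (true :: true :: b₂).drop (k - b₁.length))
        fun hmem => hnf (List.mem_of_mem_drop hmem)
      omega
  · have := hd m him
    omega

/-! ### The fraction of zeros before and after the maximum -/

/-- All heights are at most `δ` times the length. -/
def FlatPath (δ : ℝ) (l : List Bool) : Prop :=
  ∀ y ≤ l.length, |(ht (l.take y) : ℝ)| ≤ δ * l.length

/-- The step with index `i`. -/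
def stepAt (l : List Bool) (i : ℕ) : ℝ := if l[i]? = some true then 1 else -1

lemma sum_stepAt {l : List Bool} {m : ℕ} (hm : m ≤ l.length) :
    ∑ i ∈ Finset.range m, stepAt l i = ht (l.take m) := by
  induction m with
  | zero => simp
  | succ m ih =>
    rw [Finset.sum_range_succ, ih (by omega), List.take_succ_eq_append_getElem hm, ht_append, stepAt,
      List.getElem?_eq_getElem hm]
    cases l[m] <;> simp

open Classical in
-- The indices with `Q` form a final segment starting at `J`, over which the steps telescope; `J` is
-- the full length if there are none.
lemma exists_sum_stepAt_of_monotone {l : List Bool} {Q : ℕ → Prop} (hQ : ∀ i, Q i → Q (i + 1)) :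
    ∃ J ≤ l.length, ∑ i ∈ Finset.range l.length, (if Q i then stepAt l i else 0) =
      ht l - ht (l.take J) := by
  by_cases hex : ∃ i, i < l.length ∧ Q i
  · have hspec := Nat.find_spec hex
    set J := Nat.find hex with hJ
    have hup : ∀ k, Q (J + k) := by
      intro k
      induction k with
      | zero => exact hspec.2
      | succ k ih => exact hQ _ ih
    refine ⟨J, hspec.1.le, ?_⟩
    have h1 := sum_stepAt (l := l) le_rfl
    rw [List.take_length] at h1
    rw [← h1, ← sum_stepAt hspec.1.le,
      ← Finset.sum_range_add_sum_Ico (fun i => if Q i then stepAt l i else 0) hspec.1.le,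
      ← Finset.sum_range_add_sum_Ico (fun i => stepAt l i) hspec.1.le]
    have e1 : ∑ i ∈ Finset.range J, (if Q i then stepAt l i else 0) = 0 := by
      refine Finset.sum_eq_zero fun i hi => if_neg fun h => ?_
      have hi := Finset.mem_range.1 hi
      exact Nat.find_min hex hi ⟨by omega, h⟩
    have e2 : ∑ i ∈ Finset.Ico J l.length, (if Q i then stepAt l i else 0) =
        ∑ i ∈ Finset.Ico J l.length, stepAt l i := by
      refine Finset.sum_congr rfl fun i hi => if_pos ?_
      obtain ⟨k, rfl⟩ := Nat.exists_eq_add_of_le (Finset.mem_Ico.1 hi).1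
      exact hup k
    rw [e1, e2]; ring
  · refine ⟨l.length, le_rfl, ?_⟩
    rw [List.take_length, sub_self]
    refine Finset.sum_eq_zero fun i hi => if_neg fun h => hex ⟨i, Finset.mem_range.1 hi, h⟩

open Classical in
lemma FlatPath.le_sum_of_monotone {δ : ℝ} {l : List Bool} (hl : FlatPath δ l) {Q : ℕ → Prop}
    (hQ : ∀ i, Q i → Q (i + 1)) :
    -(2 * δ * l.length) ≤ ∑ i ∈ Finset.range l.length, (if Q i then stepAt l i else 0) := by
  obtain ⟨J, hJ, h⟩ := exists_sum_stepAt_of_monotone (l := l) hQ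
  rw [h]
  have h1 := abs_le.1 (hl J hJ)
  have h2 := abs_le.1 (hl l.length le_rfl)
  rw [List.take_length] at h2
  linarith [h1.2, h2.1]

open Classical in
lemma FlatPath.le_sum_of_antitone {δ : ℝ} {l : List Bool} (hl : FlatPath δ l) {Q : ℕ → Prop}
    (hQ : ∀ i, Q (i + 1) → Q i) :
    -(2 * δ * l.length) ≤ ∑ i ∈ Finset.range l.length, (if Q i then stepAt l i else 0) := by
  obtain ⟨J, hJ, h⟩ := exists_sum_stepAt_of_monotone (l := l) (Q := fun i => ¬ Q i)
    fun i hi h => hi (hQ i h)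
  have h3 := sum_stepAt (l := l) le_rfl
  rw [List.take_length] at h3
  have h4 : ∑ i ∈ Finset.range l.length, (if Q i then stepAt l i else 0) +
      ∑ i ∈ Finset.range l.length, (if ¬ Q i then stepAt l i else 0) = ht l := by
    rw [← h3, ← Finset.sum_add_distrib]
    exact Finset.sum_congr rfl fun i _ => by by_cases hq : Q i <;> simp [hq]
  have h1 := abs_le.1 (hl J hJ)
  have h0 : 0 ≤ δ * l.length := (abs_nonneg _).trans (hl J hJ)
  have h5 : ∑ i ∈ Finset.range l.length, (if ¬ Q i then stepAt l i else 0) =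
      ht l - ht (l.take J) := by convert h
  rw [h5] at h4
  linarith [h1.1]

lemma two_mul_count_true (l : List Bool) : 2 * (l.count true : ℝ) = l.length + ht l := by
  induction l with
  | nil => simp
  | cons b l ih => cases b <;> simp <;> linarith

open Classical in
-- The sum in `hQ` is twice the number of entries `true` with `Q` minus the number of all indices
-- with `Q`. Its lower bound costs `2 * δ`, and the bound `(1 + δ) / 2` on the overall density of
-- `true` costs another `δ`.
lemma FlatPath.le_goodFrac {δ : ℝ} (hδ1 : δ < 1) {l : List Bool}
    (hl : FlatPath δ l) (hn : 0 < l.length) {Q : ℕ → List Bool → Prop}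
    (hQ : -(2 * δ * l.length) ≤
      ∑ i ∈ Finset.range l.length, (if Q i l then stepAt l i else 0)) :
    (∑ i ∈ Finset.range l.length, if Q i l then 1 else 0) / l.length - 3 * δ ≤ goodFrac Q l := by
  have hn' : (0 : ℝ) < l.length := by exact_mod_cast hn
  have h2 := abs_le.1 (hl l.length le_rfl)
  rw [List.take_length] at h2
  have hδ0 : 0 ≤ δ := by
    have := (abs_nonneg _).trans (hl 0 (Nat.zero_le _))
    exact nonneg_of_mul_nonneg_left this hn'
  have hc := two_mul_count_true l
  have hc0 : (0 : ℝ) < l.count true := by nlinarith [h2.1]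
  have hsum : ∑ i ∈ Finset.range l.length, (if Q i l then stepAt l i else 0) =
      2 * ∑ i ∈ Finset.range l.length, (if l[i]? = some true ∧ Q i l then (1 : ℝ) else 0) -
        ∑ i ∈ Finset.range l.length, if Q i l then 1 else 0 := by
    rw [Finset.mul_sum, ← Finset.sum_sub_distrib]
    refine Finset.sum_congr rfl fun i _ => ?_
    unfold stepAt
    by_cases h : Q i l <;> by_cases ht : l[i]? = some true <;> simp [h, ht]; norm_num
  have hle : (∑ i ∈ Finset.range l.length, if Q i l then (1 : ℝ) else 0) ≤ l.length := by
    calc _ ≤ ∑ i ∈ Finset.range l.length, (1 : ℝ) :=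
          Finset.sum_le_sum fun i _ => by split_ifs <;> norm_num
      _ = _ := by simp
  have hW : 0 ≤ ∑ i ∈ Finset.range l.length, (if l[i]? = some true ∧ Q i l then (1 : ℝ) else 0) :=
    Finset.sum_nonneg fun i _ => by split_ifs <;> norm_num
  unfold goodFrac
  rw [hsum] at hQ
  generalize (∑ i ∈ Finset.range l.length, if Q i l then (1 : ℝ) else 0) = S at *
  generalize (∑ i ∈ Finset.range l.length,
    if l[i]? = some true ∧ Q i l then (1 : ℝ) else 0) = W at *
  rw [le_div_iff₀ hc0]
  set N : ℝ := (l.length : ℝ) with hN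
  obtain ⟨s, rfl⟩ : ∃ s, S = s * N := ⟨S / N, by field_simp⟩
  have hs1 : s ≤ 1 := by
    by_contra h
    nlinarith
  rw [mul_div_assoc, div_self hn'.ne', mul_one]
  rcases le_or_gt (s - 3 * δ) 0 with hneg | hpos
  · exact (mul_nonpos_of_nonpos_of_nonneg hneg hc0.le).trans hW
  · have : (s - 3 * δ) * (2 * l.count true) ≤ (s - 3 * δ) * (N + δ * N) := by
      apply mul_le_mul_of_nonneg_left _ hpos.le
      rw [hc]; linarith [h2.2]
    nlinarith [mul_nonneg hδ0 hn'.le, mul_nonneg (mul_nonneg hδ0 hδ0) hn'.le]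

/-- Hoeffding's bound with tilt `±δ`, from `cosh δ ≤ exp (δ ^ 2 / 2)`. -/
lemma bernProb_lt_abs_ht_le {n y : ℕ} (hy : y ≤ n) {δ : ℝ} (hδ : 0 < δ) :
    bernProb (1 / 2) y (fun l => δ * n < |(ht l : ℝ)|) ≤ 2 * Real.exp (-(δ ^ 2 / 2)) ^ n := by
  have h0 : (0 : ℝ) ≤ 1 / 2 := by norm_num
  have h1 : (1 / 2 : ℝ) ≤ 1 := by norm_num
  have hcosh : ∀ t : ℝ, t ^ 2 = δ ^ 2 →
      1 / 2 * Real.exp t + (1 - 1 / 2) / Real.exp t ≤ Real.exp (δ ^ 2 / 2) := by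
    intro t ht
    rw [← ht]
    refine le_trans (le_of_eq ?_) (Real.cosh_le_exp_half_sq t)
    rw [Real.cosh_eq, Real.exp_neg]; ring
  have key : ∀ t : ℝ, t ^ 2 = δ ^ 2 →
      bernProb (1 / 2) y (fun l => δ ^ 2 * n ≤ t * ht l) ≤ Real.exp (-(δ ^ 2 / 2)) ^ n := by
    intro t ht
    calc _ ≤ Real.exp (-(δ ^ 2 * n)) *
          (1 / 2 * Real.exp t + (1 - 1 / 2) / Real.exp t) ^ y := by
          refine bernProb_le_mul_pow h0 h1 (Real.exp_pos t) (Real.exp_nonneg _) fun l _ hl => ?_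
          rw [← Real.rpow_intCast, ← Real.exp_mul, ← Real.exp_add, Real.one_le_exp_iff]
          linarith
      _ ≤ Real.exp (-(δ ^ 2 * n)) * Real.exp (δ ^ 2 / 2) ^ y := by
          gcongr
          exact hcosh t ht
      _ ≤ Real.exp (-(δ ^ 2 * n)) * Real.exp (δ ^ 2 / 2) ^ n := by
          refine mul_le_mul_of_nonneg_left (pow_le_pow_right₀ ?_ hy) (Real.exp_nonneg _)
          exact Real.one_le_exp (by positivity)
      _ = _ := by
          rw [← Real.exp_nat_mul, ← Real.exp_nat_mul, ← Real.exp_add]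
          congr 1; ring
  calc _ ≤ bernProb (1 / 2) y (fun l => δ ^ 2 * n ≤ δ * ht l ∨ δ ^ 2 * n ≤ (-δ) * ht l) := by
        refine bernProb_mono h0 h1 fun l _ h => ?_
        rcases lt_abs.1 h with h | h
        · left; nlinarith
        · right; nlinarith
    _ ≤ _ := (bernProb_or_le h0 h1).trans (add_le_add (key δ rfl) (key (-δ) (by ring)))
    _ = _ := by ring

lemma tendsto_bernProb_not_flatPath {δ : ℝ} (hδ : 0 < δ) :
    Tendsto (fun n => bernProb (1 / 2) n fun l => ¬ FlatPath δ l) atTop (nhds 0) := by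
  have h0 : (0 : ℝ) ≤ 1 / 2 := by norm_num
  have h1 : (1 / 2 : ℝ) ≤ 1 := by norm_num
  set r := Real.exp (-(δ ^ 2 / 2)) with hr
  have hr0 : 0 ≤ r := Real.exp_nonneg _
  have hr1 : r < 1 := Real.exp_lt_one_iff.2 (by nlinarith)
  have hlim : Tendsto (fun n : ℕ => 2 * (n * r ^ n) + 2 * r ^ n) atTop (nhds 0) := by
    simpa using ((tendsto_self_mul_const_pow_of_lt_one hr0 hr1).const_mul 2).add
      ((tendsto_pow_atTop_nhds_zero_of_lt_one hr0 hr1).const_mul 2)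
  refine squeeze_zero (fun n => bernProb_nonneg h0 h1) (fun n => ?_) hlim
  calc _ ≤ bernProb (1 / 2) n (fun l => ∃ y ∈ Finset.range (n + 1),
        δ * n < |(ht (l.take y) : ℝ)|) := by
        refine bernProb_mono h0 h1 fun l hl h => ?_
        unfold FlatPath at h
        push Not at h
        obtain ⟨y, hy, hlt⟩ := h
        rw [hl] at hy hlt
        exact ⟨y, Finset.mem_range.2 (by omega), hlt⟩
    _ ≤ ∑ y ∈ Finset.range (n + 1), 2 * r ^ n := by
        refine (bernProb_exists_le h0 h1 _ _).trans (Finset.sum_le_sum fun y hy => ?_)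
        have hy : y ≤ n := Nat.lt_succ_iff.1 (Finset.mem_range.1 hy)
        refine le_trans (le_of_eq ?_) (bernProb_lt_abs_ht_le hy hδ)
        obtain ⟨m, hm⟩ := Nat.exists_eq_add_of_le hy
        conv_lhs => rw [hm]
        rw [bernProb_take (A := fun l => δ * ((y + m : ℕ) : ℝ) < |(ht l : ℝ)|), hm]
    _ = _ := by
        rw [Finset.sum_const, Finset.card_range, nsmul_eq_mul]; push_cast; ring

open Classical in
-- On a flat path the share of the zeros lying in an initial or final segment is, up to `3 * δ`, at
-- least the share of all indices lying in it.
lemma avgProb_le_bernExp_goodFrac {n : ℕ} (hn : 0 < n) {δ : ℝ} (hδ0 : 0 < δ) (hδ1 : δ < 1)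
    {Q : ℕ → List Bool → Prop}
    (hQ : (∀ l i, Q i l → Q (i + 1) l) ∨ (∀ l i, Q (i + 1) l → Q i l)) :
    avgProb (1 / 2) Q n ≤ bernExp (1 / 2) n (goodFrac Q) + 3 * δ +
      bernProb (1 / 2) n (fun l => ¬ FlatPath δ l) := by
  have h0 : (0 : ℝ) ≤ 1 / 2 := by norm_num
  have h1 : (1 / 2 : ℝ) ≤ 1 := by norm_num
  have hn' : (0 : ℝ) < n := by exact_mod_cast hn
  have e : avgProb (1 / 2) Q n =
      bernExp (1 / 2) n fun l => (1 / n : ℝ) * ∑ i ∈ Finset.range n, if Q i l then 1 else 0 := by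
    rw [bernExp_const_mul, bernExp_sum, avgProb]
    simp only [bernProb]
    ring_nf
  rw [e, ← bernExp_const (q := 1 / 2) (n := n) (3 * δ), bernProb, ← bernExp_add, ← bernExp_add]
  refine bernExp_mono h0 h1 fun l hl => ?_
  by_cases hf : FlatPath δ l
  · rw [if_neg (not_not.2 hf)]
    have hs : -(2 * δ * l.length) ≤
        ∑ i ∈ Finset.range l.length, (if Q i l then stepAt l i else 0) := by
      rcases hQ with hQ | hQ
      · exact hf.le_sum_of_monotone (hQ l)
      · exact hf.le_sum_of_antitone (hQ l)
    have := hf.le_goodFrac hδ1 (by omega) hs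
    rw [hl] at this
    rw [one_div_mul_eq_div]
    linarith
  · rw [if_pos hf]
    have hle : (∑ i ∈ Finset.range n, if Q i l then (1 : ℝ) else 0) ≤ n := by
      calc _ ≤ ∑ i ∈ Finset.range n, (1 : ℝ) :=
            Finset.sum_le_sum fun i _ => by split_ifs <;> norm_num
        _ = _ := by simp
    have h3 : (1 / n : ℝ) * ∑ i ∈ Finset.range n, (if Q i l then (1 : ℝ) else 0) ≤ 1 := by
      rw [one_div_mul_eq_div, div_le_one hn']
      exact hle
    have := goodFrac_nonneg (G := Q) (l := l)
    linarith

/-! ### The two halves in the symmetric case -/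

lemma avgProb_recordAfter (n : ℕ) :
    avgProb (1 / 2) RecordAfter n = avgProb (1 / 2) MaxBefore n := by
  unfold avgProb
  rw [← Finset.sum_range_reflect (fun i => bernProb (1 / 2) n (MaxBefore i))]
  congr 1
  exact Finset.sum_congr rfl fun i hi => bernProb_recordAfter (Finset.mem_range.1 hi)

/-- If neither `MaxBefore` nor `RecordAfter` holds, the old maximum is reached again but never
exceeded, which lies in `ReachNoDouble`. The first two have equal averages by reversal. -/
lemma le_avgProb_maxBefore {n : ℕ} (hn : 0 < n) :
    (1 - avgProb (1 / 2) ReachNoDouble n) / 2 ≤ avgProb (1 / 2) MaxBefore n := by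
  have h0 : (0 : ℝ) ≤ 1 / 2 := by norm_num
  have h1 : (1 / 2 : ℝ) ≤ 1 := by norm_num
  have hn' : (0 : ℝ) < n := by exact_mod_cast hn
  have e1 : avgProb (1 / 2) (fun _ _ => True) n = 1 := by
    have : ∀ m, bernProb (1 / 2) m (fun _ => True) = 1 := fun m => by
      simp only [bernProb, if_true]; exact bernExp_const 1
    unfold avgProb
    simp only [this]
    simp [hn'.ne']
  have e2 : avgProb (1 / 2) (fun _ _ => True) n ≤ avgProb (1 / 2) MaxBefore n +
      avgProb (1 / 2) (fun i l => RecordAfter i l ∨ ReachNoDouble i l) n := by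
    refine avgProb_le_of_or h0 h1 fun i hi l hl _ => ?_
    by_contra hcon
    push Not at hcon
    obtain ⟨hM, hR, hN⟩ := hcon
    refine hN ⟨?_, ?_⟩
    · obtain ⟨j, hj, hmax⟩ := (Finset.range (i + 1)).exists_max_image (fun y => ht (l.take y))
        ⟨0, by simp⟩
      unfold MaxBefore at hM
      push Not at hM
      obtain ⟨y, hy, hyl, h⟩ := hM j (by simpa [Nat.lt_succ_iff] using hj)
      exact ⟨y, hy, hyl, fun k hk => (hmax k (by simp; omega)).trans h⟩
    · rintro ⟨d, hd, b₁, b₂, hb, h1, h2⟩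
      refine hR ⟨i + (b₁.length + 1), by omega, ?_, fun j hj => ?_⟩
      · have := congrArg List.length hb
        simp at this; omega
      · have := hd j hj
        rw [ht_take_add, hb, show b₁ ++ true :: true :: b₂ = (b₁ ++ [true]) ++ true :: b₂ by simp,
          List.take_left' (by simp)]
        simp only [ht_append, ht_cons_true, ht_nil]
        omega
  have e3 : avgProb (1 / 2) (fun i l => RecordAfter i l ∨ ReachNoDouble i l) n ≤
      avgProb (1 / 2) RecordAfter n + avgProb (1 / 2) ReachNoDouble n :=
    avgProb_le_of_or h0 h1 fun i _ l _ h => h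
  rw [avgProb_recordAfter] at e3
  linarith

/-- If the zeros with the property `Q` are good up to a small error, then at least half of the
zeros are good. -/
lemma eventually_le_bernExp_goodFrac {Q G : ℕ → List Bool → Prop}
    (hQ : (∀ l i, Q i l → Q (i + 1) l) ∨ (∀ l i, Q (i + 1) l → Q i l))
    (havg : ∀ n, avgProb (1 / 2) Q n = avgProb (1 / 2) MaxBefore n)
    (hG : Tendsto (avgProb (1 / 2) fun i l => i < l.length ∧ Q i l ∧ ¬ G i l) atTop (nhds 0))
    {ε : ℝ} (hε : 0 < ε) : ∀ᶠ n in atTop, 1 / 2 - ε ≤ bernExp (1 / 2) n (goodFrac G) := by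
  have h0 : (0 : ℝ) ≤ 1 / 2 := by norm_num
  have h1 : (1 / 2 : ℝ) ≤ 1 := by norm_num
  -- The segment comparison loses `3 * δ < ε / 4`; the other errors are `ε / 8`, `ε / 4` and `ε /
  -- 4`.
  obtain ⟨δ, hδ0, hδ⟩ : ∃ δ : ℝ, 0 < δ ∧ δ < min 1 (ε / 12) :=
    exists_between (lt_min one_pos (by positivity))
  rw [lt_min_iff] at hδ
  filter_upwards [eventually_gt_atTop 0,
    tendsto_avgProb_reachNoDouble.eventually (gt_mem_nhds (show 0 < ε / 4 by positivity)),
    (tendsto_bernProb_not_flatPath hδ0).eventually (gt_mem_nhds (show 0 < ε / 4 by positivity)),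
    (tendsto_bernExp_goodFrac_zero (by norm_num) h1 hG).eventually
      (gt_mem_nhds (show 0 < ε / 4 by positivity))] with n hn hR hF hB
  have a1 := le_avgProb_maxBefore hn
  have a2 := avgProb_le_bernExp_goodFrac hn hδ0 hδ.1 hQ
  rw [havg] at a2
  have a3 : bernExp (1 / 2) n (goodFrac Q) ≤ bernExp (1 / 2) n (goodFrac G) +
      bernExp (1 / 2) n (goodFrac fun i l => i < l.length ∧ Q i l ∧ ¬ G i l) := by
    rw [← bernExp_add]
    refine bernExp_mono h0 h1 fun l _ => goodFrac_le_add fun i hi h => ?_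
    by_cases hg : G i l
    · exact Or.inl hg
    · exact Or.inr ⟨hi, h, hg⟩
  linarith [hδ.2]

/-- `MaxBefore` misses `LeftMax` only if no `false` follows or the path is never positive, both
negligible on average. -/
lemma eventually_le_leftMax {ε : ℝ} (hε : 0 < ε) :
    ∀ᶠ n in atTop, 1 / 2 - ε ≤ bernExp (1 / 2) n (goodFrac LeftMax) := by
  have h0 : (0 : ℝ) ≤ 1 / 2 := by norm_num
  have h1 : (1 / 2 : ℝ) ≤ 1 := by norm_num
  refine eventually_le_bernExp_goodFrac (Q := MaxBefore) (Or.inl ?_) (fun _ => rfl) ?_ hε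
  · rintro l i ⟨j, hj, h⟩
    exact ⟨j, by omega, fun y hy => h y (by omega)⟩
  · have hlim := (tendsto_avgProb_false_notMem_drop h0 (show (1 / 2 : ℝ) < 1 by norm_num)).add
      (tendsto_avgProb_zero_of_le (B := fun _ => NeverPos) h0 h1 tendsto_bernProb_neverPos
        fun n i _ => le_rfl)
    rw [add_zero] at hlim
    refine squeeze_zero (fun n => avgProb_nonneg h0 h1) (fun n => ?_) hlim
    refine avgProb_le_of_or h0 h1 ?_
    rintro i - l - ⟨hi, hM, hL⟩
    by_contra hcon
    push Not at hcon
    exact hL (leftMax_of_maxBefore hi hM hcon.1 hcon.2)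

/-- `RecordAfter` misses `RightDouble` only if the path ends at its maximum or a double record is
missing, both negligible on average. -/
lemma eventually_le_rightDouble {ε : ℝ} (hε : 0 < ε) :
    ∀ᶠ n in atTop, 1 / 2 - ε ≤ bernExp (1 / 2) n (goodFrac RightDouble) := by
  have h0 : (0 : ℝ) ≤ 1 / 2 := by norm_num
  have h1 : (1 / 2 : ℝ) ≤ 1 := by norm_num
  refine eventually_le_bernExp_goodFrac (Q := RecordAfter) (Or.inr ?_) avgProb_recordAfter ?_ hε
  · rintro l i ⟨y, hy, hyl, h⟩
    exact ⟨y, by omega, hyl, fun j hj => h j (by omega)⟩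
  · have hlim := (tendsto_avgProb_zero_of_le (B := fun _ => EndsAtMax) h0 h1
      tendsto_bernProb_neverPos fun n i _ => (bernProb_endsAtMax n).le).add
      tendsto_avgProb_reachNoDouble
    rw [add_zero] at hlim
    refine squeeze_zero (fun n => avgProb_nonneg h0 h1) (fun n => ?_) hlim
    refine avgProb_le_of_or h0 h1 ?_
    rintro i - l - ⟨hi, hM, hL⟩
    by_contra hcon
    push Not at hcon
    exact hL (rightDouble_of_recordAfter hi hM hcon.1 hcon.2)

/-! ### Convergence in law from the two lower bounds -/

lemma tendstoInDistribution_excess (p r : I)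
    (h₀ : ∀ ε > 0, ∀ᶠ n in atTop, 1 - r - ε ≤ bernExp (1 - p) n (goodFrac RightDouble))
    (h₁ : ∀ ε > 0, ∀ᶠ n in atTop, r - ε ≤ bernExp (1 - p) n (goodFrac LeftMax)) :
    TendstoInDistribution (fun (n : ℕ) (ω : Fin n → Letter) => ((excess ω : ℤ) : ℝ)) atTop
      (id : ℝ → ℝ) (initialLaw p) (bernoulliMeasure (1 : ℝ) 0 r) :=
  tendstoInDistribution_bernoulli (initialLaw p) _ (fun _ => Measurable.of_discrete) r
    (fun ε hε => (h₀ ε hε).mono fun n h => h.trans (bernExp_rightDouble_le p n))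
    (fun ε hε => (h₁ ε hε).mono fun n h => h.trans (bernExp_leftMax_le p n))

end SecondClass

theorem theorem1p2 (p : unitInterval) (hp0 : 0 < (p : ℝ)) (hp1 : (p : ℝ) < 1) :
    ((p : ℝ) > 1 / 2 →
      TendstoInDistribution (fun (n : ℕ) (ω : Fin n → SecondClass.Letter) =>
          ((SecondClass.excess ω : ℤ) : ℝ)) atTop
        (id : ℝ → ℝ) (SecondClass.initialLaw p) (Measure.dirac (1 : ℝ))) ∧
    ((p : ℝ) = 1 / 2 →
      TendstoInDistribution (fun (n : ℕ) (ω : Fin n → SecondClass.Letter) =>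
          ((SecondClass.excess ω : ℤ) : ℝ)) atTop
        (id : ℝ → ℝ) (SecondClass.initialLaw p)
        (bernoulliMeasure (1 : ℝ) 0 ⟨1 / 2, by norm_num, by norm_num⟩)) ∧
    ((p : ℝ) < 1 / 2 →
      TendstoInDistribution (fun (n : ℕ) (ω : Fin n → SecondClass.Letter) =>
          ((SecondClass.excess ω : ℤ) : ℝ)) atTop
        (id : ℝ → ℝ) (SecondClass.initialLaw p) (Measure.dirac (0 : ℝ))) := by
  have hq1 : 1 - (p : ℝ) ≤ 1 := by linarith
  refine ⟨fun hp => ?_, fun hp => ?_, fun hp => ?_⟩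
  -- Here `q = 1 - p < 1 / 2`, so the walk drifts downward. The point mass is the Bernoulli law with
  -- `r = 1`, for which the lower bound at the value 0 is vacuous.
  · have hlim := SecondClass.tendsto_bernExp_goodFrac_one (q := 1 - (p : ℝ)) (by linarith) hq1
      (SecondClass.tendsto_avgProb_not_leftMax (by linarith) (by linarith))
    have := SecondClass.tendstoInDistribution_excess p 1
      (fun ε hε => Eventually.of_forall fun n => by
        have := SecondClass.bernExp_nonneg (q := 1 - (p : ℝ)) (n := n)
          (F := SecondClass.goodFrac SecondClass.RightDouble) (by linarith) hq1
          fun l _ => SecondClass.goodFrac_nonneg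
        simp only [Set.Icc.coe_one]
        linarith)
      (fun ε hε => (hlim.eventually (lt_mem_nhds (show 1 - ε < 1 by linarith))).mono
        fun n h => by simpa using h.le)
    simpa only [bernoulliMeasure_one] using this
  · refine SecondClass.tendstoInDistribution_excess p _ (fun ε hε => ?_) fun ε hε => ?_
    · rw [show 1 - (p : ℝ) = 1 / 2 by linarith]
      filter_upwards [SecondClass.eventually_le_rightDouble hε] with n h
      linarith
    · rw [show 1 - (p : ℝ) = 1 / 2 by linarith]
      exact SecondClass.eventually_le_leftMax hε
  · have hlim := SecondClass.tendsto_bernExp_goodFrac_one (q := 1 - (p : ℝ)) (by linarith) hq1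
      (SecondClass.tendsto_avgProb_not_rightDouble (by linarith) (by linarith))
    have := SecondClass.tendstoInDistribution_excess p 0
      (fun ε hε => (hlim.eventually (lt_mem_nhds (show 1 - ε < 1 by linarith))).mono
        fun n h => by simpa using h.le)
      (fun ε hε => Eventually.of_forall fun n => by
        have := SecondClass.bernExp_nonneg (q := 1 - (p : ℝ)) (n := n)
          (F := SecondClass.goodFrac SecondClass.LeftMax) (by linarith) hq1
          fun l _ => SecondClass.goodFrac_nonneg
        simp only [Set.Icc.coe_zero]
        linarith)
    simpa only [bernoulliMeasure_zero] using this
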